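/- Let $\mathbb K$ be a field, $d\ge 0$ an integer, and $\mathcal A$ a $\mathbb K$-algebra isomorphic to $\mathrm{Mat}_{d+1}(\mathbb K)$. An element of $\mathcal A$ is multiplicity-free if it has $d+1$ distinct eigenvalues in $\mathbb K$; if $\theta_0,\dots,\theta_d$ is an ordering of the eigenvalues of such an element $A$, its primitive idempotents are $E_i=\prod_{j\ne i}(A-\theta_jI)/(\theta_i-\theta_j)$. A Leonard system in $\mathcal A$ is a sequence $\Phi=(A;A^*;\{E_i\}_{i=0}^d;\{E^*_i\}_{i=0}^d)$ such that $A,A^*\in\mathcal A$ are multiplicity-free, $E_0,\dots,E_d$ (resp. $E^*_0,\dots,E^*_d$) is an ordering of the primitive idempotents of $A$ (resp. $A^*$), and for $0\le i,j\le d$ each of $E_iA^*E_j$ and $E^*_iAE^*_j$ is $0$ if $|i-j|>1$ and nonzero if $|i-j|=1$. Let $\theta_i$ (resp. $\theta^*_i$) be the eigenvalue of $A$ (resp. $A^*$) associated with $E_i$ (resp. $E^*_i$), and let $V$ be an irreducible left $\mathcal A$-module. A $\Phi$-split decomposition of $V$ is a direct sum decomposition $V=U_0+\cdots+U_d$ into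 one-dimensional subspaces with $(A-\theta_iI)U_i\subseteq U_{i+1}$ $(0\le i<d)$, $(A-\theta_dI)U_d=0$, $(A^*-\theta^*_iI)U_i\subseteq U_{i-1}$ $(1\le i\le d)$, $(A^*-\theta^*_0I)U_0=0$. The first split sequence $\varphi_1,\dots,\varphi_d$ of $\Phi$ is given by: $\varphi_i$ is the eigenvalue of $(A-\theta_{i-1}I)(A^*-\theta^*_iI)$ on $U_i$. The second split sequence $\phi_1,\dots,\phi_d$ of $\Phi$ is the first split sequence of the Leonard system $(A;A^*;\{E_{d-i}\}_{i=0}^d;\{E^*_i\}_{i=0}^d)$. Put $\varphi_0=\varphi_{d+1}=0$. The parameter array of $\Phi$ is $(\theta_i,\theta^*_i,\,i=0..d;\ \varphi_j,\phi_j,\,j=1..d)$. A $\Phi$-standard basis of $V$ is a basis $E^*_0u,\dots,E^*_du$ with $0\ne u\in E_0V$. Let $A^\flat$ be the matrix (rows and columns indexed by $0,\dots,d$) representing $A$ with respect to a $\Phi$-standard basis. Define $b_i=(A^\flat)_{i,i+1}$ $(0\le i\le d-1)$, $c_i=(A^\flat)_{i,i-1}$ $(1\le i\le d)$, $a_i=\mathrm{tr}(E^*_iA)$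 $(0\le i\le d)$, $x_i=\mathrm{tr}(E^*_iAE^*_{i-1}A)$ $(1\le i\le d)$, $m_i=\mathrm{tr}(E_iE^*_0)$, $\nu=\mathrm{tr}(E_0E^*_0)^{-1}$, and $k_i=\nu\,\mathrm{tr}(E^*_iE_0)$ $(0\le i\le d)$. For $0\le i\le d+1$ let $$\tau_i=\prod_{h=0}^{i-1}(\lambda-\theta_h),\quad \tau^*_i=\prod_{h=0}^{i-1}(\lambda-\theta^*_h),\quad \eta_i=\prod_{h=0}^{i-1}(\lambda-\theta_{d-h}),\quad \eta^*_i=\prod_{h=0}^{i-1}(\lambda-\theta^*_{d-h}).$$ Theorem. The parameter array of $\Phi$ and a $\Phi$-standard basis of $V$ exist, $\mathrm{tr}(E_0E^*_0)\neq 0$, $\varphi_j\ne0$ and $\phi_j\neq 0$ for $1\le j\le d$, and, for every $\Phi$-standard basis, $$b_i=\varphi_{i+1}\frac{\tau^*_i(\theta^*_i)}{\tau^*_{i+1}(\theta^*_{i+1})}\quad(0\le i\le d-1),\qquad c_i=\phi_i\frac{\eta^*_{d-i}(\theta^*_i)}{\eta^*_{d-i+1}(\theta^*_{i-1})}\quad(1\le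 i\le d);$$ $$a_i=\theta_i+\frac{\varphi_i}{\theta^*_i-\theta^*_{i-1}}+\frac{\varphi_{i+1}}{\theta^*_i-\theta^*_{i+1}}\quad(0\le i\le d),$$ where the fraction with numerator $\varphi_0$ (for $i=0$) and the one with numerator $\varphi_{d+1}$ (for $i=d$) are read as $0$; $$x_i=\varphi_i\phi_i\,\frac{\tau^*_{i-1}(\theta^*_{i-1})\,\eta^*_{d-i}(\theta^*_i)}{\tau^*_i(\theta^*_i)\,\eta^*_{d-i+1}(\theta^*_{i-1})}\quad(1\le i\le d),\qquad \nu=\frac{\eta_d(\theta_0)\,\eta^*_d(\theta^*_0)}{\phi_1\phi_2\cdots\phi_d};$$ $$k_i=\frac{\varphi_1\cdots\varphi_i}{\phi_1\cdots\phi_i}\,\frac{\eta^*_d(\theta^*_0)}{\tau^*_i(\theta^*_i)\,\eta^*_{d-i}(\theta^*_i)},\qquad m_i=\frac{\varphi_1\cdots\varphi_i\,\phi_1\cdots\phi_{d-i}}{\eta^*_d(\theta^*_0)\,\tau_i(\theta_i)\,\eta_{d-i}(\theta_i)}\quad(0\le i\le d).$$ -/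

import Mathlib

/-- An element `X` of `𝒜` (to be isomorphic to `Mat_{d+1}(K)`) is multiplicity-free:
it has `d + 1` mutually distinct eigenvalues in `K`. -/
def IsMultiplicityFree (K : Type*) {𝒜 : Type*} [Field K] [Ring 𝒜] [Algebra K 𝒜]
    (d : ℕ) (X : 𝒜) : Prop :=
  (spectrum K X).ncard = d + 1

/-- `θ_0, …, θ_d` is an ordering of the eigenvalues of `X`, and for each `i` the element `E_i` is the
primitive idempotent `∏_{j ≠ i} (X - θ_j I) / (θ_i - θ_j)` of `X` associated with `θ_i`. -/
structure IsPrimitiveIdempotentOrdering {K 𝒜 : Type*} [Field K] [Ring 𝒜] [Algebra K 𝒜]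
    {d : ℕ} (X : 𝒜) (θ : Fin (d + 1) → K) (E : Fin (d + 1) → 𝒜) : Prop where
  injective : Function.Injective θ
  range_eq : Set.range θ = spectrum K X
  idempotent_eq : ∀ i, E i = Polynomial.aeval X
    (∏ j ∈ Finset.univ.erase i, (Polynomial.C (θ i - θ j)⁻¹ * (Polynomial.X - Polynomial.C (θ j))))

/-- A Leonard system `(A; A*; {E_i}; {E*_i})` of diameter `d` in the `K`-algebra `𝒜`.
(The ambient algebra is assumed isomorphic to `Mat_{d+1}(K)` where the notion is used.) -/
structure LeonardSystem (K 𝒜 : Type*) [Field K] [Ring 𝒜] [Algebra K 𝒜] (d : ℕ) where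
  A : 𝒜
  As : 𝒜
  E : Fin (d + 1) → 𝒜
  Es : Fin (d + 1) → 𝒜
  multFree : IsMultiplicityFree K d A
  multFree_s : IsMultiplicityFree K d As
  ordering : ∃ θ : Fin (d + 1) → K, IsPrimitiveIdempotentOrdering A θ E
  ordering_s : ∃ θs : Fin (d + 1) → K, IsPrimitiveIdempotentOrdering As θs Es
  zero_far : ∀ i j : Fin (d + 1), 1 < |(i : ℤ) - (j : ℤ)| → E i * As * E j = 0
  ne_zero_near : ∀ i j : Fin (d + 1), |(i : ℤ) - (j : ℤ)| = 1 → E i * As * E j ≠ 0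
  zero_far_s : ∀ i j : Fin (d + 1), 1 < |(i : ℤ) - (j : ℤ)| → Es i * A * Es j = 0
  ne_zero_near_s : ∀ i j : Fin (d + 1), |(i : ℤ) - (j : ℤ)| = 1 → Es i * A * Es j ≠ 0

theorem IsPrimitiveIdempotentOrdering.rev {K 𝒜 : Type*} [Field K] [Ring 𝒜] [Algebra K 𝒜]
    {d : ℕ} {X : 𝒜} {θ : Fin (d + 1) → K} {E : Fin (d + 1) → 𝒜}
    (h : IsPrimitiveIdempotentOrdering X θ E) :
    IsPrimitiveIdempotentOrdering X (fun i => θ i.rev) (fun i => E i.rev) where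
  injective := h.injective.comp Fin.rev_injective
  range_eq := by
    rw [← h.range_eq]
    exact Fin.rev_surjective.range_comp θ
  idempotent_eq i := by
    rw [h.idempotent_eq]
    congr 1
    refine Finset.prod_bij' (fun j _ => j.rev) (fun j _ => j.rev) ?_ ?_ ?_ ?_ ?_
    · intro j hj
      simp only [Finset.mem_erase, Finset.mem_univ, and_true] at hj ⊢
      intro hji
      exact hj (by rw [← hji, Fin.rev_rev])
    · intro j hj
      simp only [Finset.mem_erase, Finset.mem_univ, and_true] at hj ⊢
      intro hji
      exact hj (Fin.rev_injective hji)
    · simp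
    · simp
    · simp

namespace LeonardSystem

/-- The system `Φ* = (A*; A; {E*_i}; {E_i})`. -/
def dual {K 𝒜 : Type*} [Field K] [Ring 𝒜] [Algebra K 𝒜] {d : ℕ}
    (Φ : LeonardSystem K 𝒜 d) : LeonardSystem K 𝒜 d where
  A := Φ.As
  As := Φ.A
  E := Φ.Es
  Es := Φ.E
  multFree := Φ.multFree_s
  multFree_s := Φ.multFree
  ordering := Φ.ordering_s
  ordering_s := Φ.ordering
  zero_far := Φ.zero_far_s
  ne_zero_near := Φ.ne_zero_near_s
  zero_far_s := Φ.zero_far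
  ne_zero_near_s := Φ.ne_zero_near

theorem abs_rev_sub_rev {d : ℕ} (i j : Fin (d + 1)) :
    |(i.rev : ℤ) - (j.rev : ℤ)| = |(i : ℤ) - (j : ℤ)| := by
  have h : (i.rev : ℤ) - (j.rev : ℤ) = -((i : ℤ) - (j : ℤ)) := by
    have hi := i.isLt
    have hj := j.isLt
    simp only [Fin.val_rev]
    omega
  rw [h, abs_neg]

/-- The system `Φ^⇓ = (A; A*; {E_{d-i}}; {E*_i})`. -/
def ddown {K 𝒜 : Type*} [Field K] [Ring 𝒜] [Algebra K 𝒜] {d : ℕ}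
    (Φ : LeonardSystem K 𝒜 d) : LeonardSystem K 𝒜 d where
  A := Φ.A
  As := Φ.As
  E := fun i => Φ.E i.rev
  Es := Φ.Es
  multFree := Φ.multFree
  multFree_s := Φ.multFree_s
  ordering := ⟨_, Φ.ordering.choose_spec.rev⟩
  ordering_s := Φ.ordering_s
  zero_far := fun i j h => Φ.zero_far _ _ (by rwa [abs_rev_sub_rev])
  ne_zero_near := fun i j h => Φ.ne_zero_near _ _ (by rwa [abs_rev_sub_rev])
  zero_far_s := Φ.zero_far_s
  ne_zero_near_s := Φ.ne_zero_near_s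

/-- The eigenvalue sequence of `Φ`: `θ_i` is the eigenvalue of `A` associated with `E_i`. -/
noncomputable def eigenvalue {K 𝒜 : Type*} [Field K] [Ring 𝒜] [Algebra K 𝒜] {d : ℕ}
    (Φ : LeonardSystem K 𝒜 d) : Fin (d + 1) → K :=
  Φ.ordering.choose

/-- The dual eigenvalue sequence of `Φ`. -/
noncomputable def dualEigenvalue {K 𝒜 : Type*} [Field K] [Ring 𝒜] [Algebra K 𝒜] {d : ℕ}
    (Φ : LeonardSystem K 𝒜 d) : Fin (d + 1) → K :=
  Φ.dual.eigenvalue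

theorem eigenvalue_spec {K 𝒜 : Type*} [Field K] [Ring 𝒜] [Algebra K 𝒜] {d : ℕ}
    (Φ : LeonardSystem K 𝒜 d) : IsPrimitiveIdempotentOrdering Φ.A Φ.eigenvalue Φ.E :=
  Φ.ordering.choose_spec

/-- The trace of an element of `𝒜`, computed through its action on the irreducible module `V`. -/
noncomputable def tr {K 𝒜 : Type*} [Field K] [Ring 𝒜] [Algebra K 𝒜]
    (V : Type*) [AddCommGroup V] [Module K V] [Module 𝒜 V] [IsScalarTower K 𝒜 V] (X : 𝒜) : K :=
  LinearMap.trace K V (Algebra.lsmul K K V X)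

section Scalars

variable {K 𝒜 : Type*} [Field K] [Ring 𝒜] [Algebra K 𝒜] {d : ℕ} (Φ : LeonardSystem K 𝒜 d)
variable (V : Type*) [AddCommGroup V] [Module K V] [Module 𝒜 V] [IsScalarTower K 𝒜 V]

/-- `a_i = tr(E*_i A)`. -/
noncomputable def a (i : Fin (d + 1)) : K := tr V (Φ.Es i * Φ.A)

/-- `x_i = tr(E*_i A E*_{i-1} A)` for `1 ≤ i ≤ d`, and `x_0 = 0`. -/
noncomputable def x (i : ℕ) : K :=
  if h : 1 ≤ i ∧ i ≤ d then
    tr V (Φ.Es ⟨i, by omega⟩ * Φ.A * Φ.Es ⟨i - 1, by omega⟩ * Φ.A)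
  else 0

/-- `m_i = tr(E_i E*_0)`. -/
noncomputable def m (i : Fin (d + 1)) : K := tr V (Φ.E i * Φ.Es 0)

/-- `ν`, the multiplicative inverse of `m_0 = tr(E_0 E*_0)`. -/
noncomputable def nu : K := (Φ.m V 0)⁻¹

/-- `k_i = m*_i ν`, where `m*_i` is the scalar `m_i` of `Φ*`. -/
noncomputable def k (i : Fin (d + 1)) : K := Φ.dual.m V i * Φ.nu V

variable {V}

/-- `v` is a `Φ`-standard basis: `v_i = E*_i u` for a nonzero vector `u ∈ E_0 V`. -/
def IsStandardBasis (v : Module.Basis (Fin (d + 1)) K V) : Prop :=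
  ∃ u : V, u ≠ 0 ∧ (∃ w : V, u = Φ.E 0 • w) ∧ ∀ i, v i = Φ.Es i • u

/-- The matrix representing `X ∈ 𝒜` with respect to the basis `v`
(it is `X^♭` when `v` is a `Φ`-standard basis): `X v_j = ∑ i, Y_ij v_i`. -/
noncomputable def repMatrix (v : Module.Basis (Fin (d + 1)) K V) (X : 𝒜) :
    Matrix (Fin (d + 1)) (Fin (d + 1)) K :=
  LinearMap.toMatrix v v (Algebra.lsmul K K V X)

/-- `b_i`, the `(i, i+1)` entry of `A^♭` for `0 ≤ i ≤ d - 1`, and `b_d = 0`.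
Here `v` is the `Φ`-standard basis used to compute `A^♭`. -/
noncomputable def b (v : Module.Basis (Fin (d + 1)) K V) (i : ℕ) : K :=
  if h : i < d then repMatrix v Φ.A ⟨i, by omega⟩ ⟨i + 1, by omega⟩ else 0

/-- `c_i`, the `(i, i-1)` entry of `A^♭` for `1 ≤ i ≤ d`, and `c_0 = 0`.
Here `v` is the `Φ`-standard basis used to compute `A^♭`. -/
noncomputable def c (v : Module.Basis (Fin (d + 1)) K V) (i : ℕ) : K :=
  if h : 1 ≤ i ∧ i ≤ d then repMatrix v Φ.A ⟨i, by omega⟩ ⟨i - 1, by omega⟩ else 0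

/-- `U_0, …, U_d` is a `Φ`-split decomposition of `V`. -/
structure IsSplitDecomposition (U : Fin (d + 1) → Submodule K V) : Prop where
  finrank_eq_one : ∀ i, Module.finrank K (U i) = 1
  isInternal : DirectSum.IsInternal U
  raise : ∀ i : Fin d, ∀ u ∈ U i.castSucc,
    (Φ.A - algebraMap K 𝒜 (Φ.eigenvalue i.castSucc)) • u ∈ U i.succ
  raise_last : ∀ u ∈ U (Fin.last d),
    (Φ.A - algebraMap K 𝒜 (Φ.eigenvalue (Fin.last d))) • u = 0
  lower : ∀ i : Fin d, ∀ u ∈ U i.succ,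
    (Φ.As - algebraMap K 𝒜 (Φ.dualEigenvalue i.succ)) • u ∈ U i.castSucc
  lower_zero : ∀ u ∈ U 0, (Φ.As - algebraMap K 𝒜 (Φ.dualEigenvalue 0)) • u = 0

variable (V)

/-- `φ_1, …, φ_d` is the first split sequence of `Φ`: for `1 ≤ i ≤ d`, `φ_i` is the eigenvalue of
`(A - θ_{i-1} I)(A* - θ*_i I)` on the component `U_i` of the `Φ`-split decomposition
(the variable `i : Fin d` below stands for `i - 1`). By convention `φ_0 = φ_{d+1} = 0`. -/
def IsFirstSplitSequence (φ : ℕ → K) : Prop :=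
  φ 0 = 0 ∧ φ (d + 1) = 0 ∧
  ∃ U : Fin (d + 1) → Submodule K V, Φ.IsSplitDecomposition U ∧
    ∀ i : Fin d, ∀ u ∈ U i.succ,
      ((Φ.A - algebraMap K 𝒜 (Φ.eigenvalue i.castSucc)) *
        (Φ.As - algebraMap K 𝒜 (Φ.dualEigenvalue i.succ))) • u = φ (i + 1) • u

/-- `(θ_i, θ*_i, i = 0..d; φ_j, ϕ_j, j = 1..d)` is the parameter array of `Φ`; the second split
sequence `ϕ` of `Φ` is the first split sequence of `Φ^⇓`. The values of `θ`, `θ*` at indices above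
`d` and those of `φ`, `ϕ` at indices above `d + 1` are arbitrary. -/
structure IsParameterArray (θ θs φ ϕ : ℕ → K) : Prop where
  eigenvalue_eq : ∀ i : Fin (d + 1), θ i = Φ.eigenvalue i
  dualEigenvalue_eq : ∀ i : Fin (d + 1), θs i = Φ.dualEigenvalue i
  firstSplit : Φ.IsFirstSplitSequence V φ
  secondSplit : Φ.ddown.IsFirstSplitSequence V ϕ

end Scalars

/-- `τ_i = ∏_{h=0}^{i-1} (λ - θ_h)`; applied to `θ*` this is `τ*_i`. -/
noncomputable def tau {K : Type*} [Field K] (θ : ℕ → K) (i : ℕ) : Polynomial K :=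
  ∏ h ∈ Finset.range i, (Polynomial.X - Polynomial.C (θ h))

/-- `η_i = ∏_{h=0}^{i-1} (λ - θ_{d-h})` for `0 ≤ i ≤ d + 1`; applied to `θ*` this is `η*_i`. -/
noncomputable def eta {K : Type*} [Field K] (d : ℕ) (θ : ℕ → K) (i : ℕ) : Polynomial K :=
  ∏ h ∈ Finset.range i, (Polynomial.X - Polynomial.C (θ (d - h)))

end LeonardSystem

/-! Take eigenbases w_i of A and v_i of A* (written B) in V, with coordinate functionals q_i and
p_i, scaled so that w_0 is the sum of the v_i; then the v_i form a standard basis. Everything is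
read off from the vectors τ_i(A)v_0 (`split`). Since A is tridiagonal on the v_j, such a vector has
no v_j-coordinate for j > i, and its v_i-coordinate is c_1⋯c_i (`lead`). Since A is diagonal on the
w_h, it has no w_h-coordinate for h < i. The two flags are opposite (`eq_zero_of_flags`), which
forces (B - θ*_{i+1}) τ_{i+1}(A)v_0 = φ_{i+1} τ_i(A)v_0.

The v_i-coordinate of (A - θ_i) τ_i(A)v_0 = τ_{i+1}(A)v_0 gives a_i. For c_i, reverse the θ's:
η_d(A)v_0 = c_1⋯c_d w_0, and lowering this vector with B produces the ϕ's. Its v_i-coordinates give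
ϕ_{i+1}⋯ϕ_d c_1⋯c_i = c_1⋯c_d η*_{d-i}(θ*_i) (`prod_mul_lead`), and c_i is a quotient of consecutive
instances.

Evaluating q_0 on τ*_i(B) τ_i(A)v_0 in two ways gives q_0(v_i) c_1⋯c_i τ*_i(θ*_i) = φ_1⋯φ_i q_0(v_0)
(`q_zero_v`). With the balance relation b_i q_0(v_i) = c_{i+1} q_0(v_{i+1}) this yields b_i. Then
x_i = b_{i-1} c_i, tr(E_0 E*_0) = q_0(v_0) and k_i = q_0(v_i)/q_0(v_0). Exchanging A and A* keeps φ
and ν and reverses ϕ, so the formula for k_i turns into the one for m_i. -/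

/-- `w_0, …, w_d` is a basis of eigenvectors of `X` with mutually distinct eigenvalues `θ_i`, and
`q_0, …, q_d` are the coordinate functionals of this basis. -/
structure IsEigenframe {K V : Type*} [Field K] [AddCommGroup V] [Module K V] (d : ℕ)
    (X : Module.End K V) (θ : ℕ → K) (w : ℕ → V) (q : ℕ → Module.Dual K V) : Prop where
  inj : ∀ i ≤ d, ∀ j ≤ d, θ i = θ j → i = j
  coord_self : ∀ i ≤ d, q i (w i) = 1
  coord_ne : ∀ i ≤ d, ∀ j ≤ d, i ≠ j → q i (w j) = 0
  coord_zero : ∀ i, d < i → q i = 0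
  sum_coord : ∀ x, ∑ i ∈ Finset.range (d + 1), q i x • w i = x
  map_eq : ∀ i ≤ d, X (w i) = θ i • w i

/-- The matrix of `Y` in the basis `w_0, …, w_d` with coordinate functionals `q_0, …, q_d`
is irreducible tridiagonal. -/
structure IsIrreducibleTridiagonal {K V : Type*} [Field K] [AddCommGroup V] [Module K V] (d : ℕ)
    (Y : Module.End K V) (w : ℕ → V) (q : ℕ → Module.Dual K V) : Prop where
  far_up : ∀ i ≤ d, ∀ j ≤ d, i + 1 < j → q i (Y (w j)) = 0
  far_down : ∀ i ≤ d, ∀ j ≤ d, i + 1 < j → q j (Y (w i)) = 0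
  up : ∀ i < d, q i (Y (w (i + 1))) ≠ 0
  down : ∀ i < d, q (i + 1) (Y (w i)) ≠ 0

/-! ### Coordinates and three-term expansions in an eigenbasis -/

namespace IsEigenframe

variable {K V : Type*} [Field K] [AddCommGroup V] [Module K V] {d : ℕ}
  {X Y : Module.End K V} {θ : ℕ → K} {w : ℕ → V} {q : ℕ → Module.Dual K V}

theorem ext_zero (h : IsEigenframe d X θ w q) {x : V} (hx : ∀ i ≤ d, q i x = 0) : x = 0 := by
  rw [← h.sum_coord x]
  refine Finset.sum_eq_zero fun i hi => ?_
  rw [hx i (by simpa [Nat.lt_succ_iff] using hi), zero_smul]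

theorem functional_apply (h : IsEigenframe d X θ w q) (f : Module.Dual K V) (x : V) :
    f x = ∑ i ∈ Finset.range (d + 1), q i x * f (w i) := by
  conv_lhs => rw [← h.sum_coord x]
  simp

theorem functional_comp_apply (h : IsEigenframe d X θ w q) (f : Module.Dual K V) (x : V) :
    f (Y x) = ∑ i ∈ Finset.range (d + 1), q i x * f (Y (w i)) :=
  h.functional_apply (f.comp Y) x

theorem coord_map (h : IsEigenframe d X θ w q) (i : ℕ) (x : V) : q i (X x) = θ i * q i x := by
  by_cases hi : d < i
  · simp [h.coord_zero i hi]
  rw [h.functional_comp_apply, Finset.sum_eq_single i]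
  · simp [h.map_eq i (by omega), h.coord_self i (by omega), mul_comm]
  · intro j hj hji
    have hj' : j ≤ d := by simpa [Nat.lt_succ_iff] using hj
    simp [h.map_eq j hj', h.coord_ne i (by omega) j hj' (Ne.symm hji)]
  · intro hi'
    exact absurd (Finset.mem_range.2 (by omega)) hi'

theorem coord_aeval (h : IsEigenframe d X θ w q) (f : Polynomial K) (i : ℕ) (x : V) :
    q i (Polynomial.aeval X f x) = f.eval (θ i) * q i x := by
  induction f using Polynomial.induction_on generalizing x with
  | C a => simp
  | add f g hf hg => simp [hf, hg, add_mul]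
  | monomial n a ih =>
    have e : Polynomial.aeval X (Polynomial.C a * Polynomial.X ^ (n + 1)) x
        = Polynomial.aeval X (Polynomial.C a * Polynomial.X ^ n) (X x) := by
      simp [pow_succ]
    rw [e, ih, h.coord_map]
    simp only [Polynomial.eval_mul, Polynomial.eval_C, Polynomial.eval_pow, Polynomial.eval_X]
    ring

theorem eq_smul_of_coord_eq_zero (h : IsEigenframe d X θ w q) {i : ℕ} (hi : i ≤ d) {x : V}
    (hx : ∀ j ≤ d, j ≠ i → q j x = 0) : x = q i x • w i := by
  rw [← sub_eq_zero]
  refine h.ext_zero fun j hj => ?_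
  by_cases hji : j = i
  · subst hji; simp [h.coord_self j hj]
  · simp [hx j hj hji, h.coord_ne j hj i hi hji]

theorem eq_smul_of_map_eq (h : IsEigenframe d X θ w q) {i : ℕ} (hi : i ≤ d) {x : V}
    (hx : X x = θ i • x) : x = q i x • w i := by
  refine h.eq_smul_of_coord_eq_zero hi fun j hj hji => ?_
  have := h.coord_map j x
  rw [hx, map_smul, smul_eq_mul] at this
  have h2 : (θ i - θ j) * q j x = 0 := by linear_combination this
  rcases mul_eq_zero.1 h2 with h3 | h3
  · exact absurd (h.inj _ hj _ hi (sub_eq_zero.1 h3).symm) hji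
  · exact h3

/-- The `coord_*_tridiagonal` lemmas expand along a row of Y, the `functional_map_*` lemmas along a
column. The index may run to d + 1: the functional q_{d+1} is zero, so the unspecified vector
w_{d+1} never contributes. -/
theorem coord_zero_tridiagonal (h : IsEigenframe d X θ w q)
    (ht : IsIrreducibleTridiagonal d Y w q) (x : V) :
    q 0 (Y x) = q 0 x * q 0 (Y (w 0)) + q 1 x * q 0 (Y (w 1)) := by
  rw [h.functional_comp_apply]
  have : ∑ i ∈ Finset.range (d + 1), q i x * q 0 (Y (w i))
      = ∑ i ∈ Finset.range 2, q i x * q 0 (Y (w i)) := by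
    -- For d = 0 the window {0, 1} leaves `range (d + 1)`; both sums are compared over `range (d +
    -- 2)`, where the extra term vanishes.
    rw [Finset.sum_subset (Finset.range_subset_range.2 (show 2 ≤ d + 2 by omega)),
      Finset.sum_range_succ _ (d + 1), h.coord_zero (d + 1) (by omega)]
    · simp
    · intro j hj hj'
      simp only [Finset.mem_range] at hj hj'
      by_cases hjd : j ≤ d
      · simp [ht.far_up 0 (by omega) j hjd (by omega)]
      · simp [h.coord_zero j (by omega)]
  rw [this]
  simp [Finset.sum_range_succ]

theorem functional_map_zero (h : IsEigenframe d X θ w q)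
    (ht : IsIrreducibleTridiagonal d Y w q) (f : Module.Dual K V) :
    f (Y (w 0)) = q 0 (Y (w 0)) * f (w 0) + q 1 (Y (w 0)) * f (w 1) := by
  rw [h.functional_apply f]
  have : ∑ i ∈ Finset.range (d + 1), q i (Y (w 0)) * f (w i)
      = ∑ i ∈ Finset.range 2, q i (Y (w 0)) * f (w i) := by
    rw [Finset.sum_subset (Finset.range_subset_range.2 (show 2 ≤ d + 2 by omega)),
      Finset.sum_range_succ _ (d + 1), h.coord_zero (d + 1) (by omega)]
    · simp
    · intro j hj hj'
      simp only [Finset.mem_range] at hj hj'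
      by_cases hjd : j ≤ d
      · simp [ht.far_down 0 (by omega) j hjd (by omega)]
      · simp [h.coord_zero j (by omega)]
  rw [this]
  simp [Finset.sum_range_succ]

theorem functional_map_succ (h : IsEigenframe d X θ w q)
    (ht : IsIrreducibleTridiagonal d Y w q) {i : ℕ} (hi : i < d) (f : Module.Dual K V) :
    f (Y (w (i + 1))) = q i (Y (w (i + 1))) * f (w i) + q (i + 1) (Y (w (i + 1))) * f (w (i + 1))
      + q (i + 2) (Y (w (i + 1))) * f (w (i + 2)) := by
  rw [h.functional_apply f]
  have : ∑ j ∈ Finset.range (d + 1), q j (Y (w (i + 1))) * f (w j)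
      = ∑ j ∈ Finset.Ico i (i + 3), q j (Y (w (i + 1))) * f (w j) := by
    have hs : Finset.Ico i (i + 3) ⊆ Finset.range (d + 2) := by
      intro j hj
      simp only [Finset.mem_Ico, Finset.mem_range] at hj ⊢
      omega
    rw [Finset.sum_subset hs, Finset.sum_range_succ _ (d + 1), h.coord_zero (d + 1) (by omega)]
    · simp
    · intro j hj hj'
      simp only [Finset.mem_range, Finset.mem_Ico] at hj hj'
      by_cases hjd : j ≤ d
      · by_cases hji : j < i
        · simp [ht.far_up j hjd (i + 1) (by omega) (by omega)]
        · simp [ht.far_down (i + 1) (by omega) j hjd (by omega)]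
      · simp [h.coord_zero j (by omega)]
  rw [this]
  simp [Finset.sum_Ico_succ_top, add_assoc]

theorem coord_succ_tridiagonal (h : IsEigenframe d X θ w q)
    (ht : IsIrreducibleTridiagonal d Y w q) {i : ℕ} (hi : i < d) (x : V) :
    q (i + 1) (Y x) = q i x * q (i + 1) (Y (w i)) + q (i + 1) x * q (i + 1) (Y (w (i + 1)))
      + q (i + 2) x * q (i + 1) (Y (w (i + 2))) := by
  rw [h.functional_comp_apply]
  have : ∑ j ∈ Finset.range (d + 1), q j x * q (i + 1) (Y (w j))
      = ∑ j ∈ Finset.Ico i (i + 3), q j x * q (i + 1) (Y (w j)) := by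
    have hs : Finset.Ico i (i + 3) ⊆ Finset.range (d + 2) := by
      intro j hj
      simp only [Finset.mem_Ico, Finset.mem_range] at hj ⊢
      omega
    rw [Finset.sum_subset hs, Finset.sum_range_succ _ (d + 1), h.coord_zero (d + 1) (by omega)]
    · simp
    · intro j hj hj'
      simp only [Finset.mem_range, Finset.mem_Ico] at hj hj'
      by_cases hjd : j ≤ d
      · by_cases hji : j < i
        · simp [ht.far_down j hjd (i + 1) (by omega) (by omega)]
        · simp [ht.far_up (i + 1) (by omega) j hjd (by omega)]
      · simp [h.coord_zero j (by omega)]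
  rw [this]
  simp [Finset.sum_Ico_succ_top, add_assoc]

end IsEigenframe

/-! ### Leonard frames, split vectors and existence of the split sequences -/

/-- A pair of linear maps `A`, `B` with eigenframes `(w, q)` of `A` and `(v, p)` of `B`,
such that each of `A`, `B` is irreducible tridiagonal in the eigenframe of the other one. -/
structure LeonardFrame (K V : Type*) [Field K] [AddCommGroup V] [Module K V] (d : ℕ) where
  A : Module.End K V
  B : Module.End K V
  θ : ℕ → K
  θs : ℕ → K
  w : ℕ → V
  q : ℕ → Module.Dual K V
  v : ℕ → V
  p : ℕ → Module.Dual K V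
  frame : IsEigenframe d A θ w q
  frame_s : IsEigenframe d B θs v p
  tridiag : IsIrreducibleTridiagonal d B w q
  tridiag_s : IsIrreducibleTridiagonal d A v p

namespace LeonardFrame

open LeonardSystem

variable {K V : Type*} [Field K] [AddCommGroup V] [Module K V] {d : ℕ} (L : LeonardFrame K V d)

theorem eval_tau (θ : ℕ → K) (i : ℕ) (x : K) :
    (tau θ i).eval x = ∏ h ∈ Finset.range i, (x - θ h) := by
  simp [tau, Polynomial.eval_prod]

theorem eval_eta (θ : ℕ → K) (i : ℕ) (x : K) :
    (eta d θ i).eval x = ∏ h ∈ Finset.range i, (x - θ (d - h)) := by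
  simp [eta, Polynomial.eval_prod]

theorem eval_eta_succ (θ : ℕ → K) (i : ℕ) (x : K) :
    (eta d θ (i + 1)).eval x = (eta d θ i).eval x * (x - θ (d - i)) := by
  rw [eval_eta, eval_eta, Finset.prod_range_succ]

theorem eval_tau_eq_zero (θ : ℕ → K) {i j : ℕ} (h : j < i) : (tau θ i).eval (θ j) = 0 := by
  rw [eval_tau]
  exact Finset.prod_eq_zero (Finset.mem_range.2 h) (sub_self _)

theorem degree_tau (θ : ℕ → K) (i : ℕ) : (tau θ i).degree = i := by
  simp [tau, Polynomial.degree_prod]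

/-- The frame with the roles of `A` and `B` exchanged. -/
def dual : LeonardFrame K V d where
  A := L.B
  B := L.A
  θ := L.θs
  θs := L.θ
  w := L.v
  q := L.p
  v := L.w
  p := L.q
  frame := L.frame_s
  frame_s := L.frame
  tridiag := L.tridiag_s
  tridiag_s := L.tridiag

/-- The frame with the order of the eigenvectors of `A` inverted. -/
def ddown : LeonardFrame K V d where
  A := L.A
  B := L.B
  θ := fun i => L.θ (d - i)
  θs := L.θs
  w := fun i => L.w (d - i)
  q := fun i => if i ≤ d then L.q (d - i) else 0
  v := L.v
  p := L.p
  frame_s := L.frame_s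
  tridiag_s := L.tridiag_s
  frame :=
    { inj := fun i hi j hj h => by
        have := L.frame.inj _ (Nat.sub_le d i) _ (Nat.sub_le d j) h
        omega
      coord_self := fun i hi => by simp [hi, L.frame.coord_self _ (Nat.sub_le d i)]
      coord_ne := fun i hi j hj hij => by
        simp [hi, L.frame.coord_ne _ (Nat.sub_le d i) _ (Nat.sub_le d j) (by omega)]
      coord_zero := fun i hi => by simp [not_le.2 hi]
      sum_coord := fun x => by
        rw [← Finset.sum_range_reflect]
        conv_rhs => rw [← L.frame.sum_coord x]
        refine Finset.sum_congr rfl fun i hi => ?_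
        have hi' : i < d + 1 := Finset.mem_range.1 hi
        rw [if_pos (by omega), show d - (d + 1 - 1 - i) = i by omega]
      map_eq := fun i hi => L.frame.map_eq _ (Nat.sub_le d i) }
  tridiag :=
    { far_up := fun i hi j hj h => by
        simpa [hi] using L.tridiag.far_down _ (Nat.sub_le d j) _ (Nat.sub_le d i) (by omega)
      far_down := fun i hi j hj h => by
        simpa [hj] using L.tridiag.far_up _ (Nat.sub_le d j) _ (Nat.sub_le d i) (by omega)
      up := fun i hi => by
        have := L.tridiag.down (d - (i + 1)) (by omega)
        rw [show d - (i + 1) + 1 = d - i by omega] at this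
        simpa [hi.le] using this
      down := fun i hi => by
        have := L.tridiag.up (d - (i + 1)) (by omega)
        rw [show d - (i + 1) + 1 = d - i by omega] at this
        simpa [Nat.succ_le_of_lt hi] using this }

theorem theta_sub_ne_zero {i j : ℕ} (hi : i ≤ d) (hj : j ≤ d) (hij : i ≠ j) :
    L.θ i - L.θ j ≠ 0 :=
  fun h => hij (L.frame.inj i hi j hj (sub_eq_zero.1 h))

theorem thetas_sub_ne_zero {i j : ℕ} (hi : i ≤ d) (hj : j ≤ d) (hij : i ≠ j) :
    L.θs i - L.θs j ≠ 0 :=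
  L.dual.theta_sub_ne_zero hi hj hij

theorem eval_tau_self_ne_zero {i j : ℕ} (hj : j ≤ d) (hij : i ≤ j) :
    (tau L.θ i).eval (L.θ j) ≠ 0 := by
  rw [eval_tau, Finset.prod_ne_zero_iff]
  intro h hh
  have := Finset.mem_range.1 hh
  exact L.theta_sub_ne_zero hj (by omega) (by omega)

theorem eval_eta_ne_zero {i j : ℕ} (hij : j + i ≤ d) : (eta d L.θ i).eval (L.θ j) ≠ 0 := by
  rw [eval_eta, Finset.prod_ne_zero_iff]
  intro h hh
  have := Finset.mem_range.1 hh
  exact L.theta_sub_ne_zero (by omega) (by omega) (by omega)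

/-- A functional that is a left eigenvector of `B` and vanishes at `w_0` is zero. -/
theorem functional_eq_zero {f : Module.Dual K V} {t : K} (hf : ∀ x, f (L.B x) = t * f x)
    (h0 : f (L.w 0) = 0) : f = 0 := by
  have key : ∀ n, ∀ j ≤ n, j ≤ d → f (L.w j) = 0 := by
    intro n
    induction n with
    | zero => intro j hj _; rwa [Nat.le_zero.1 hj]
    | succ n ih =>
      intro j hj hjd
      rcases Nat.lt_or_ge j (n + 1) with h | h
      · exact ih j (by omega) hjd
      obtain rfl : j = n + 1 := by omega
      -- Three-term recurrence: in f(B w_n) = t f(w_n) the values of f at w_0, …, w_n vanish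
      -- already, so f(w_{n+1}) times a nonzero subdiagonal entry is 0.
      have e := L.frame.functional_apply f (L.B (L.w n))
      rw [hf, ih n le_rfl (by omega), mul_zero, Finset.sum_eq_single (n + 1)] at e
      · exact (mul_eq_zero.1 e.symm).resolve_left (L.tridiag.down n (by omega))
      · intro i hi hin
        have hi' := Finset.mem_range.1 hi
        rcases Nat.lt_or_ge i (n + 1) with h | h
        · rw [ih i (by omega) (by omega), mul_zero]
        · rw [L.tridiag.far_down n (by omega) i (by omega) (by omega), zero_mul]
      · intro hn
        exact absurd (Finset.mem_range.2 (by omega)) hn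
  ext x
  rw [L.frame.functional_apply f x]
  refine Finset.sum_eq_zero fun i hi => ?_
  have := Finset.mem_range.1 hi
  rw [key i i le_rfl (by omega), mul_zero]

/-- An eigenvector of `B` has nonzero `w_0`-coordinate. -/
theorem eq_zero_of_coord_zero {x : V} {t : K} (hx : L.B x = t • x) (h0 : L.q 0 x = 0) :
    x = 0 := by
  have key : ∀ n, ∀ j ≤ n, j ≤ d → L.q j x = 0 := by
    intro n
    induction n with
    | zero => intro j hj _; rwa [Nat.le_zero.1 hj]
    | succ n ih =>
      intro j hj hjd
      rcases Nat.lt_or_ge j (n + 1) with h | h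
      · exact ih j (by omega) hjd
      obtain rfl : j = n + 1 := by omega
      have e := L.frame.functional_comp_apply (Y := L.B) (L.q n) x
      rw [hx, map_smul, ih n le_rfl (by omega), smul_zero,
        Finset.sum_eq_single (n + 1)] at e
      · exact (mul_eq_zero.1 e.symm).resolve_right (L.tridiag.up n (by omega))
      · intro i hi hin
        have hi' := Finset.mem_range.1 hi
        rcases Nat.lt_or_ge i (n + 1) with h | h
        · rw [ih i (by omega) (by omega), zero_mul]
        · rw [L.tridiag.far_up n (by omega) i (by omega) (by omega), mul_zero]
      · intro hn
        exact absurd (Finset.mem_range.2 (by omega)) hn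
  exact L.frame.ext_zero fun i hi => key i i le_rfl hi

theorem p_w_zero_ne_zero {i : ℕ} (hi : i ≤ d) : L.p i (L.w 0) ≠ 0 := by
  intro h
  have := L.functional_eq_zero (fun x => L.frame_s.coord_map i x) h
  have h1 := L.frame_s.coord_self i hi
  rw [this] at h1
  simp at h1

theorem q_v_zero_ne_zero {i : ℕ} (hi : i ≤ d) : L.q i (L.v 0) ≠ 0 :=
  L.dual.p_w_zero_ne_zero hi

/-- The vectors `τ_i(A) v_0`, which span the components of the split decomposition. -/
noncomputable def split (i : ℕ) : V := Polynomial.aeval L.A (tau L.θ i) (L.v 0)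

/-- The `v_i`-coordinate of `split i`. -/
noncomputable def lead (i : ℕ) : K := ∏ j ∈ Finset.range i, L.p (j + 1) (L.A (L.v j))

theorem split_zero : L.split 0 = L.v 0 := by simp [split, tau]

theorem split_succ (i : ℕ) : L.split (i + 1) = L.A (L.split i) - L.θ i • L.split i := by
  rw [split, tau, Finset.prod_range_succ, mul_comm]
  simp [split, tau, Module.End.mul_apply]

theorem lead_ne_zero {i : ℕ} (hi : i ≤ d) : L.lead i ≠ 0 := by
  rw [lead, Finset.prod_ne_zero_iff]
  intro j hj
  have := Finset.mem_range.1 hj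
  exact L.tridiag_s.down j (by omega)

theorem lead_succ (i : ℕ) : L.lead (i + 1) = L.lead i * L.p (i + 1) (L.A (L.v i)) :=
  Finset.prod_range_succ _ _

/-- Each factor A - θ_h raises the largest v-index by at most one. -/
theorem p_split_of_lt (i : ℕ) : ∀ j, i < j → j ≤ d → L.p j (L.split i) = 0 := by
  induction i with
  | zero =>
    intro j hj hjd
    rw [split_zero, L.frame_s.coord_ne j hjd 0 (by omega) (by omega)]
  | succ i ih =>
    intro j hj hjd
    obtain ⟨j, rfl⟩ : ∃ k, j = k + 1 := ⟨j - 1, by omega⟩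
    rw [split_succ, map_sub, map_smul, L.frame_s.coord_succ_tridiagonal L.tridiag_s (by omega),
      ih j (by omega) (by omega), ih (j + 1) (by omega) hjd]
    by_cases h : j + 2 ≤ d
    · rw [ih (j + 2) (by omega) h]; simp
    · rw [L.frame_s.coord_zero (j + 2) (by omega)]; simp

theorem p_split_self {i : ℕ} (hi : i ≤ d) : L.p i (L.split i) = L.lead i := by
  induction i with
  | zero => rw [split_zero, L.frame_s.coord_self 0 (by omega)]; simp [lead]
  | succ i ih =>
    rw [split_succ, map_sub, map_smul, L.frame_s.coord_succ_tridiagonal L.tridiag_s (by omega),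
      ih (by omega), L.p_split_of_lt i (i + 1) (by omega) hi, lead_succ]
    by_cases h : i + 2 ≤ d
    · rw [L.p_split_of_lt i (i + 2) (by omega) h]; simp
    · rw [L.frame_s.coord_zero (i + 2) (by omega)]; simp

theorem split_ne_zero {i : ℕ} (hi : i ≤ d) : L.split i ≠ 0 := by
  intro h
  have := L.p_split_self hi
  rw [h, map_zero] at this
  exact L.lead_ne_zero hi this.symm

theorem q_split (i h : ℕ) : L.q h (L.split i) = (tau L.θ i).eval (L.θ h) * L.q h (L.v 0) :=
  L.frame.coord_aeval _ _ _

theorem q_split_of_lt {i h : ℕ} (hi : h < i) : L.q h (L.split i) = 0 := by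
  rw [q_split, eval_tau_eq_zero _ hi, zero_mul]

theorem split_last_succ : L.split (d + 1) = 0 :=
  L.frame.ext_zero fun _ hi => L.q_split_of_lt (by omega)

theorem A_split (i : ℕ) : L.A (L.split i) = L.θ i • L.split i + L.split (i + 1) := by
  rw [split_succ]; abel

/-- The split vectors are triangular against the v_j with nonzero leading coordinates, so the top
coordinate of x can be removed step by step. -/
theorem mem_span_split (n : ℕ) (hn : n ≤ d + 1) (x : V) (hx : ∀ j, n ≤ j → j ≤ d → L.p j x = 0) :
    x ∈ Submodule.span K (L.split '' Set.Iio n) := by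
  induction n generalizing x with
  | zero => rw [L.frame_s.ext_zero fun j hj => hx j (by omega) hj]; exact zero_mem _
  | succ n ih =>
    have h1 : x - (L.p n x / L.lead n) • L.split n ∈ Submodule.span K (L.split '' Set.Iio n) := by
      refine ih (by omega) _ fun j hj hjd => ?_
      rcases hj.eq_or_lt with rfl | hj
      · rw [map_sub, map_smul, L.p_split_self hjd, smul_eq_mul,
          div_mul_cancel₀ _ (L.lead_ne_zero hjd), sub_self]
      · rw [map_sub, map_smul, hx j hj hjd, L.p_split_of_lt n j hj hjd]; simp
    have h2 : L.split n ∈ Submodule.span K (L.split '' Set.Iio (n + 1)) :=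
      Submodule.subset_span ⟨n, Nat.lt_succ_self n, rfl⟩
    have h3 := Submodule.span_mono (Set.image_mono (f := L.split)
      (Set.Iio_subset_Iio (Nat.le_succ n))) h1
    simpa using add_mem h3 (Submodule.smul_mem _ (L.p n x / L.lead n) h2)

theorem exists_aeval_of_mem_span {n : ℕ} {x : V}
    (hx : x ∈ Submodule.span K (L.split '' Set.Iio n)) :
    ∃ f ∈ Polynomial.degreeLT K n, Polynomial.aeval L.A f (L.v 0) = x := by
  induction hx using Submodule.span_induction with
  | mem x hx =>
    obtain ⟨i, hi, rfl⟩ := hx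
    refine ⟨tau L.θ i, ?_, rfl⟩
    rw [Polynomial.mem_degreeLT, degree_tau]
    exact_mod_cast hi
  | zero => exact ⟨0, zero_mem _, by simp⟩
  | add x y _ _ hx hy =>
    obtain ⟨f, hf, rfl⟩ := hx
    obtain ⟨g, hg, rfl⟩ := hy
    exact ⟨f + g, add_mem hf hg, by simp⟩
  | smul a x _ hx =>
    obtain ⟨f, hf, rfl⟩ := hx
    exact ⟨a • f, Submodule.smul_mem _ a hf, by simp⟩

/-- Opposite flags: the conditions on p make x = f(A)v_0 with deg f < n, and those on q give f the n
distinct roots θ_0, …, θ_{n-1}, because q_h(v_0) ≠ 0. -/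
theorem eq_zero_of_flags {n : ℕ} (hn : n ≤ d + 1) {x : V} (hp : ∀ j, n ≤ j → j ≤ d → L.p j x = 0)
    (hq : ∀ h < n, L.q h x = 0) : x = 0 := by
  obtain ⟨f, hf, rfl⟩ := L.exists_aeval_of_mem_span (L.mem_span_split n hn x hp)
  have : f = 0 := by
    refine Polynomial.eq_zero_of_degree_lt_of_eval_index_eq_zero (s := Finset.range n) (v := L.θ)
      ?_ ?_ ?_
    · intro i hi j hj hij
      simp only [Finset.coe_range, Set.mem_Iio] at hi hj
      exact L.frame.inj i (by omega) j (by omega) hij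
    · rw [Finset.card_range]; exact Polynomial.mem_degreeLT.1 hf
    · intro i hi
      have hi' := Finset.mem_range.1 hi
      have := hq i hi'
      rw [L.frame.coord_aeval] at this
      exact (mul_eq_zero.1 this).resolve_right (L.q_v_zero_ne_zero (by omega))
  simp [this]

/-- `φ` is the first split sequence of the frame. -/
def IsSplitSequence (φ : ℕ → K) : Prop :=
  ∀ i < d, L.B (L.split (i + 1)) = L.θs (i + 1) • L.split (i + 1) + φ (i + 1) • L.split i

/-- Subtracting θ*_{i+1} kills the v_{i+1}-coordinate, and B lowers the first w-index by at most
one. After removal of the v_i-coordinate the rest meets both conditions of `eq_zero_of_flags` at n =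
i. -/
theorem exists_B_split_succ {i : ℕ} (hi : i < d) :
    ∃ t : K, L.B (L.split (i + 1)) = L.θs (i + 1) • L.split (i + 1) + t • L.split i := by
  set y := L.B (L.split (i + 1)) - L.θs (i + 1) • L.split (i + 1) with hy
  have hpy : ∀ j, L.p j y = (L.θs j - L.θs (i + 1)) * L.p j (L.split (i + 1)) := fun j => by
    rw [hy, map_sub, map_smul, L.frame_s.coord_map, smul_eq_mul]; ring
  refine ⟨L.p i y / L.lead i, ?_⟩
  have h0 : y - (L.p i y / L.lead i) • L.split i = 0 := by
    refine L.eq_zero_of_flags (n := i) (by omega) (fun j hj hjd => ?_) (fun h hh => ?_)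
    · rw [map_sub, map_smul, smul_eq_mul]
      rcases hj.eq_or_lt with rfl | hj
      · rw [L.p_split_self hjd, div_mul_cancel₀ _ (L.lead_ne_zero hjd), sub_self]
      · rw [L.p_split_of_lt i j hj hjd, hpy, mul_zero, sub_zero]
        rcases (Nat.succ_le_of_lt hj).eq_or_lt with hj | hj
        · rw [← hj, sub_self, zero_mul]
        · rw [L.p_split_of_lt (i + 1) j hj hjd, mul_zero]
    · rw [map_sub, map_smul, L.q_split_of_lt hh, hy, map_sub, map_smul,
        L.q_split_of_lt (by omega : h < i + 1)]
      rw [L.frame.functional_comp_apply, Finset.sum_eq_zero]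
      · simp
      · intro j hj
        have hj' := Finset.mem_range.1 hj
        rcases Nat.lt_or_ge j (i + 1) with h1 | h1
        · rw [L.q_split_of_lt h1, zero_mul]
        · rw [L.tridiag.far_up h (by omega) j (by omega) (by omega), mul_zero]
  rw [sub_eq_zero] at h0
  rw [← h0, hy]; abel

theorem exists_isSplitSequence : ∃ φ : ℕ → K, L.IsSplitSequence φ ∧ φ 0 = 0 ∧ φ (d + 1) = 0 := by
  choose! f hf using fun i (hi : i < d) => L.exists_B_split_succ hi
  -- The scalar found for `split (i + 1)` is stored at index i + 1; both boundary values are set to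
  -- 0.
  refine ⟨fun i => if i = 0 ∨ i = d + 1 then 0 else f (i - 1), fun i hi => ?_, by simp, by simp⟩
  have : ¬ (i = d) := by omega
  simpa [this] using hf i hi

/-- Otherwise `split (i + 1)` would be a nonzero eigenvector of B without w_0-coordinate. -/
theorem IsSplitSequence.ne_zero {φ : ℕ → K} (hφ : L.IsSplitSequence φ) {i : ℕ} (hi : i < d) :
    φ (i + 1) ≠ 0 := by
  intro h
  have h1 := hφ i hi
  rw [h, zero_smul, add_zero] at h1
  exact L.split_ne_zero (by omega) (L.eq_zero_of_coord_zero h1 (L.q_split_of_lt (by omega)))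

end LeonardFrame

/-! ### Matrix entries and coordinates in terms of the split sequences -/

namespace LeonardFrame

open LeonardSystem

variable {K V : Type*} [Field K] [AddCommGroup V] [Module K V] {d : ℕ} (L : LeonardFrame K V d)

theorem prod_range_sub_mul_prod_range (f : ℕ → K) {i : ℕ} (hi : i ≤ d) :
    (∏ h ∈ Finset.range (d - i), f (d - h)) * ∏ j ∈ Finset.range i, f (j + 1)
      = ∏ j ∈ Finset.range d, f (j + 1) := by
  obtain ⟨n, rfl⟩ := Nat.exists_eq_add_of_le hi
  rw [Finset.prod_range_add, mul_comm, Nat.add_sub_cancel_left,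
    ← Finset.prod_range_reflect (fun x => f (i + x + 1))]
  congr 1
  refine Finset.prod_congr rfl fun h hh => ?_
  have := Finset.mem_range.1 hh
  congr 1
  omega

theorem prod_Icc_one (f : ℕ → K) (i : ℕ) :
    ∏ j ∈ Finset.Icc 1 i, f j = ∏ j ∈ Finset.range i, f (j + 1) := by
  induction i with
  | zero => simp
  | succ i ih => rw [Finset.prod_Icc_succ_top (by omega), ih, Finset.prod_range_succ]

/-- The frame is normalized if `w_0` is the sum of the `v_i`. -/
def IsNormalized : Prop := ∀ i ≤ d, L.p i (L.w 0) = 1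

variable {L} {φ ϕ : ℕ → K}

/-- This is the v_i-coordinate of the lowering relation. For i = d the denominator is arbitrary, but
τ_{d+1}(A)v_0 = 0 and φ_{d+1} = 0. -/
theorem p_split_succ (hφ : L.IsSplitSequence φ) (hφd : φ (d + 1) = 0) {i : ℕ} (hi : i ≤ d) :
    L.p i (L.split (i + 1)) = L.lead i * (φ (i + 1) / (L.θs i - L.θs (i + 1))) := by
  rcases hi.eq_or_lt with rfl | hi'
  · simp [L.split_last_succ, hφd]
  have h := congrArg (L.p i) (hφ i hi')
  rw [L.frame_s.coord_map, map_add, map_smul, map_smul, L.p_split_self hi] at h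
  have := L.thetas_sub_ne_zero hi (Nat.succ_le_of_lt hi') (by omega)
  simp only [smul_eq_mul] at h
  field_simp
  linear_combination h

theorem diag_eq (hφ : L.IsSplitSequence φ) (hφ0 : φ 0 = 0) (hφd : φ (d + 1) = 0) {i : ℕ}
    (hi : i ≤ d) : L.p i (L.A (L.v i)) = L.θ i + φ i / (L.θs i - L.θs (i - 1))
      + φ (i + 1) / (L.θs i - L.θs (i + 1)) := by
  have h := congrArg (L.p i) (L.A_split i)
  rw [map_add, map_smul, L.p_split_self hi, p_split_succ hφ hφd hi] at h
  have hl := L.lead_ne_zero hi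
  refine mul_left_cancel₀ hl ?_
  -- For i = 0 truncated subtraction makes the denominator θ*_0 - θ*_0; the fraction is 0 in any
  -- case, since φ_0 = 0.
  rcases i with _ | i
  · rw [L.split_zero] at h
    simp only [hφ0, zero_div, add_zero, smul_eq_mul] at h ⊢
    simp only [lead, Finset.range_zero, Finset.prod_empty, one_mul] at h ⊢
    linear_combination h
  · rw [L.frame_s.coord_succ_tridiagonal L.tridiag_s (by omega), L.p_split_self hi,
      p_split_succ hφ hφd (by omega)] at h
    have h0 : L.p (i + 2) (L.split (i + 1)) = 0 := by
      by_cases h2 : i + 2 ≤ d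
      · exact L.p_split_of_lt _ _ (by omega) h2
      · simp [L.frame_s.coord_zero (i + 2) (by omega)]
    have hs := L.thetas_sub_ne_zero hi (Nat.le_of_succ_le hi) (by omega)
    have hneg : φ (i + 1) / (L.θs i - L.θs (i + 1)) = - (φ (i + 1) / (L.θs (i + 1) - L.θs i)) := by
      rw [← neg_sub, div_neg]
    rw [h0, zero_mul, add_zero, hneg] at h
    rw [Nat.add_sub_cancel]
    have hls := L.lead_succ i
    simp only [smul_eq_mul] at h
    linear_combination h - (φ (i + 1) / (L.θs (i + 1) - L.θs i)) * hls

/-- η_d(A) kills every w_j with j ≠ 0, so η_d(A)v_0 is a multiple of w_0. The v_d-coordinate finds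
the factor; reversing the θ's leaves `lead` unchanged. -/
theorem ddown_split_last (hn : L.IsNormalized) : L.ddown.split d = L.lead d • L.w 0 := by
  have h : L.ddown.split d = L.ddown.q d (L.ddown.split d) • L.ddown.w d :=
    L.ddown.frame.eq_smul_of_coord_eq_zero le_rfl fun j hj hjd =>
      L.ddown.q_split_of_lt (by omega)
  have hw : L.ddown.w d = L.w 0 := congrArg L.w (Nat.sub_self d)
  have h1 := congrArg (L.p d) h
  rw [hw, map_smul, hn d le_rfl, smul_eq_mul, mul_one] at h1
  rw [hw, ← h1] at h
  rw [h]
  exact congrArg (· • L.w 0) (L.ddown.p_split_self le_rfl)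

theorem lead_last_eq (hn : L.IsNormalized) :
    L.lead d = (eta d L.θ d).eval (L.θ 0) * L.q 0 (L.v 0) := by
  have h := L.ddown.q_split d d
  rw [ddown_split_last hn] at h
  have hq : L.ddown.q d = L.q 0 := by simp [ddown]
  have ht : L.ddown.θ d = L.θ 0 := congrArg L.θ (Nat.sub_self d)
  rw [hq, ht, map_smul, L.frame.coord_self 0 (by omega), smul_eq_mul, mul_one] at h
  exact h

/-- Descending induction from η_d(A)v_0: each lowering by B - θ*_{d-k} contributes ϕ_{d-k} on the
split vector and θ*_i - θ*_{d-k} on the v_i-coordinate. -/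
theorem prod_mul_p_ddown_split (hn : L.IsNormalized) (hϕ : L.ddown.IsSplitSequence ϕ) {i : ℕ}
    (hi : i ≤ d) {k : ℕ} (hk : k ≤ d) :
    (∏ h ∈ Finset.range k, ϕ (d - h)) * L.p i (L.ddown.split (d - k))
      = L.lead d * (eta d L.θs k).eval (L.θs i) := by
  induction k with
  | zero =>
    rw [Nat.sub_zero, ddown_split_last hn, map_smul, hn i hi]
    simp [eta]
  | succ k ih =>
    have h := congrArg (L.p i) (hϕ (d - (k + 1)) (by omega))
    rw [show d - (k + 1) + 1 = d - k by omega, show L.ddown.B = L.B from rfl,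
      L.frame_s.coord_map, map_add, map_smul, map_smul, show L.ddown.θs = L.θs from rfl] at h
    simp only [smul_eq_mul] at h
    rw [Finset.prod_range_succ, eval_eta_succ]
    linear_combination (L.θs i - L.θs (d - k)) * ih (by omega)
      - (∏ h ∈ Finset.range k, ϕ (d - h)) * h

theorem prod_mul_lead (hn : L.IsNormalized) (hϕ : L.ddown.IsSplitSequence ϕ) {i : ℕ}
    (hi : i ≤ d) : (∏ h ∈ Finset.range (d - i), ϕ (d - h)) * L.lead i
      = L.lead d * (eta d L.θs (d - i)).eval (L.θs i) := by
  rw [← prod_mul_p_ddown_split hn hϕ hi (Nat.sub_le d i), Nat.sub_sub_self hi]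
  exact congrArg _ (L.ddown.p_split_self hi).symm

theorem prod_range_ne_zero (hφ : L.IsSplitSequence φ) {i : ℕ} (hi : i ≤ d) :
    ∏ j ∈ Finset.range i, φ (j + 1) ≠ 0 := by
  rw [Finset.prod_ne_zero_iff]
  intro j hj
  have := Finset.mem_range.1 hj
  exact hφ.ne_zero L (by omega)

theorem prod_range_sub_ne_zero (hφ : L.IsSplitSequence φ) {i : ℕ} (hi : i ≤ d) :
    ∏ h ∈ Finset.range i, φ (d - h) ≠ 0 := by
  rw [Finset.prod_ne_zero_iff]
  intro j hj
  have := Finset.mem_range.1 hj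
  have h2 := hφ.ne_zero L (i := d - j - 1) (by omega)
  rwa [show d - j - 1 + 1 = d - j by omega] at h2

theorem prod_eq_lead_last_mul (hn : L.IsNormalized) (hϕ : L.ddown.IsSplitSequence ϕ) :
    ∏ j ∈ Finset.range d, ϕ (j + 1) = L.lead d * (eta d L.θs d).eval (L.θs 0) := by
  have h := prod_mul_lead hn hϕ (Nat.zero_le d)
  have h2 := prod_range_sub_mul_prod_range ϕ (Nat.zero_le d)
  rw [← h2]
  simpa [lead] using h

theorem subdiag_eq (hn : L.IsNormalized) (hϕ : L.ddown.IsSplitSequence ϕ) {i : ℕ} (hi : i < d) :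
    L.p (i + 1) (L.A (L.v i)) = ϕ (i + 1) * ((eta d L.θs (d - (i + 1))).eval (L.θs (i + 1))
      / (eta d L.θs (d - (i + 1) + 1)).eval (L.θs i)) := by
  have h1 := prod_mul_lead hn hϕ hi.le
  have h2 := prod_mul_lead hn hϕ (Nat.succ_le_of_lt hi)
  have e : d - i = d - (i + 1) + 1 := by omega
  rw [e, Finset.prod_range_succ, show d - (d - (i + 1)) = i + 1 by omega] at h1
  rw [Nat.succ_eq_add_one, lead_succ] at h2
  have hη : (eta d L.θs (d - (i + 1) + 1)).eval (L.θs i) ≠ 0 :=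
    L.dual.eval_eta_ne_zero (by omega)
  have hP := prod_range_sub_ne_zero hϕ (Nat.sub_le d (i + 1))
  rw [mul_div_assoc', eq_div_iff hη]
  -- The formula is the quotient of `prod_mul_lead` at i + 1 and i; these nonzero factors clear the
  -- denominators.
  refine mul_left_cancel₀ (mul_ne_zero (mul_ne_zero hP (L.lead_ne_zero hi.le))
    (L.lead_ne_zero le_rfl)) ?_
  linear_combination L.lead d * (eta d L.θs (d - (i + 1) + 1)).eval (L.θs i) * h2
    - L.lead d * (eta d L.θs (d - (i + 1))).eval (L.θs (i + 1)) * h1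

/-- B - θ*_k sends `split j` to (θ*_j - θ*_k) `split j` + φ_j `split (j - 1)`. By induction only
indices k and k + 1 matter; the first coefficient vanishes at j = k, the second yields φ_{k+1}. -/
theorem q_zero_aeval_split (hφ : L.IsSplitSequence φ) {k : ℕ} (hk : k ≤ d) (j : ℕ) (hj : j ≤ d) :
    L.q 0 (Polynomial.aeval L.B (tau L.θs k) (L.split j))
      = if j = k then (∏ i ∈ Finset.range k, φ (i + 1)) * L.q 0 (L.v 0) else 0 := by
  induction k generalizing j with
  | zero =>
    rcases j with _ | j
    · simp [tau, split_zero]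
    · simp [tau, L.q_split_of_lt (Nat.succ_pos j)]
  | succ k ih =>
    have e : Polynomial.aeval L.B (tau L.θs (k + 1)) (L.split j)
        = Polynomial.aeval L.B (tau L.θs k) (L.B (L.split j) - L.θs k • L.split j) := by
      rw [tau, Finset.prod_range_succ]
      simp [tau, Module.End.mul_apply]
    rw [e]
    rcases j with _ | j
    · rw [split_zero, L.frame_s.map_eq 0 (by omega), ← sub_smul, map_smul, map_smul, ← split_zero,
        ih (by omega) 0 hj]
      rcases k with _ | k <;> simp
    · rw [hφ j (by omega)]
      simp only [map_sub, map_add, map_smul, ih (by omega) j (by omega), ih (by omega) (j + 1) hj]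
      by_cases hjk : j = k
      · subst hjk
        simp [Finset.prod_range_succ]
        ring
      · by_cases hjk' : j + 1 = k
        · subst hjk'
          simp
        · simp [hjk, hjk']

/-- τ*_i(B) kills v_j for j < i and `split i` has no v_j for j > i, so τ*_i(B) `split i` is a
multiple of v_i; then apply q_0. -/
theorem q_zero_v (hφ : L.IsSplitSequence φ) {i : ℕ} (hi : i ≤ d) :
    L.q 0 (L.v i) * L.lead i * (tau L.θs i).eval (L.θs i)
      = (∏ j ∈ Finset.range i, φ (j + 1)) * L.q 0 (L.v 0) := by
  have h := q_zero_aeval_split hφ hi i hi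
  have e : Polynomial.aeval L.B (tau L.θs i) (L.split i)
      = ((tau L.θs i).eval (L.θs i) * L.lead i) • L.v i := by
    rw [L.frame_s.eq_smul_of_coord_eq_zero hi (x := Polynomial.aeval L.B (tau L.θs i) (L.split i))]
    · rw [L.frame_s.coord_aeval, L.p_split_self hi]
    · intro j hj hji
      rw [L.frame_s.coord_aeval]
      rcases Nat.lt_or_ge j i with hlt | hge
      · rw [eval_tau_eq_zero _ hlt, zero_mul]
      · rw [L.p_split_of_lt i j (by omega) hj, mul_zero]
  rw [e, if_pos rfl, map_smul, smul_eq_mul] at h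
  linear_combination h

/-- Balance relation: the rows of A sum to θ_0, as A w_0 = θ_0 w_0 with w_0 the sum of the v_i,
while q_0 ∘ A = θ_0 q_0 governs the columns. The diagonal terms cancel and the difference
telescopes. -/
theorem superdiag_mul_q_zero_v (hn : L.IsNormalized) {i : ℕ} (hi : i < d) :
    L.p i (L.A (L.v (i + 1))) * L.q 0 (L.v i)
      = L.p (i + 1) (L.A (L.v i)) * L.q 0 (L.v (i + 1)) := by
  have hA := L.frame.map_eq 0 (Nat.zero_le d)
  induction i with
  | zero =>
    have h1 := L.frame_s.coord_zero_tridiagonal L.tridiag_s (L.w 0)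
    rw [hA, map_smul, hn 0 (by omega), hn 1 (by omega)] at h1
    have h2 := L.frame_s.functional_map_zero L.tridiag_s (L.q 0)
    rw [L.frame.coord_map] at h2
    simp only [smul_eq_mul] at h1
    linear_combination h2 - L.q 0 (L.v 0) * h1
  | succ i ih =>
    have h1 := L.frame_s.coord_succ_tridiagonal L.tridiag_s (i := i) (by omega) (L.w 0)
    rw [hA, map_smul, hn i (by omega), hn (i + 1) (by omega), hn (i + 2) (by omega)] at h1
    have h2 := L.frame_s.functional_map_succ L.tridiag_s (i := i) (by omega) (L.q 0)
    rw [L.frame.coord_map] at h2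
    simp only [smul_eq_mul] at h1
    linear_combination h2 - L.q 0 (L.v (i + 1)) * h1 + ih (by omega)

theorem superdiag_eq (hn : L.IsNormalized) (hφ : L.IsSplitSequence φ) {i : ℕ} (hi : i < d) :
    L.p i (L.A (L.v (i + 1))) = φ (i + 1) * ((tau L.θs i).eval (L.θs i)
      / (tau L.θs (i + 1)).eval (L.θs (i + 1))) := by
  have h1 := q_zero_v hφ hi.le
  have h2 := q_zero_v hφ (Nat.succ_le_of_lt hi)
  have h3 := superdiag_mul_q_zero_v hn hi
  rw [Nat.succ_eq_add_one, lead_succ, Finset.prod_range_succ] at h2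
  have hτ : (tau L.θs (i + 1)).eval (L.θs (i + 1)) ≠ 0 :=
    L.dual.eval_tau_self_ne_zero (Nat.succ_le_of_lt hi) le_rfl
  rw [mul_div_assoc', eq_div_iff hτ]
  refine mul_left_cancel₀ (mul_ne_zero (prod_range_ne_zero hφ hi.le)
    (L.q_v_zero_ne_zero (Nat.zero_le d))) ?_
  linear_combination (tau L.θs i).eval (L.θs i) * h2
    - L.p i (L.A (L.v (i + 1))) * (tau L.θs (i + 1)).eval (L.θs (i + 1)) * h1
    + L.lead i * (tau L.θs i).eval (L.θs i) * (tau L.θs (i + 1)).eval (L.θs (i + 1)) * h3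

theorem q_zero_v_zero_inv (hn : L.IsNormalized) (hϕ : L.ddown.IsSplitSequence ϕ) :
    (L.q 0 (L.v 0))⁻¹ = ((eta d L.θ d).eval (L.θ 0) * (eta d L.θs d).eval (L.θs 0))
      / ∏ j ∈ Finset.range d, ϕ (j + 1) := by
  have h0 := L.q_v_zero_ne_zero (Nat.zero_le d)
  have hP := prod_range_ne_zero hϕ le_rfl
  rw [eq_div_iff hP, prod_eq_lead_last_mul hn hϕ, lead_last_eq hn]
  field_simp

theorem q_zero_v_div (hn : L.IsNormalized) (hφ : L.IsSplitSequence φ)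
    (hϕ : L.ddown.IsSplitSequence ϕ) {i : ℕ} (hi : i ≤ d) :
    L.q 0 (L.v i) * (L.q 0 (L.v 0))⁻¹
      = ((∏ j ∈ Finset.range i, φ (j + 1)) / ∏ j ∈ Finset.range i, ϕ (j + 1))
        * ((eta d L.θs d).eval (L.θs 0)
          / ((tau L.θs i).eval (L.θs i) * (eta d L.θs (d - i)).eval (L.θs i))) := by
  have h0 := L.q_v_zero_ne_zero (Nat.zero_le d)
  have hP := prod_range_ne_zero hϕ hi
  have hQ := prod_range_sub_ne_zero hϕ (Nat.sub_le d i)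
  have hτ : (tau L.θs i).eval (L.θs i) ≠ 0 := L.dual.eval_tau_self_ne_zero hi le_rfl
  have hη : (eta d L.θs (d - i)).eval (L.θs i) ≠ 0 := L.dual.eval_eta_ne_zero (by omega)
  have h1 := q_zero_v hφ hi
  have h2 := prod_mul_lead hn hϕ hi
  have h3 := prod_eq_lead_last_mul hn hϕ
  rw [← prod_range_sub_mul_prod_range ϕ hi] at h3
  rw [div_mul_div_comm, ← div_eq_mul_inv, div_eq_div_iff h0 (mul_ne_zero hP (mul_ne_zero hτ hη))]
  refine mul_left_cancel₀ hQ ?_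
  linear_combination L.q 0 (L.v i) * (tau L.θs i).eval (L.θs i)
      * (eta d L.θs (d - i)).eval (L.θs i) * h3
    - L.q 0 (L.v i) * (tau L.θs i).eval (L.θs i) * (eta d L.θs d).eval (L.θs 0) * h2
    + (∏ h ∈ Finset.range (d - i), ϕ (d - h)) * (eta d L.θs d).eval (L.θs 0) * h1

/-! ### Exchange of A and B -/

/-- The first split sequence is unchanged when `A` and `B` are exchanged. -/
theorem IsSplitSequence.dual (hn : L.IsNormalized) (hφ : L.IsSplitSequence φ) :
    L.dual.IsSplitSequence φ := by
  obtain ⟨ψ, hψ, -, -⟩ := L.dual.exists_isSplitSequence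
  have hz : ∀ i, ∀ j ≤ d, L.p j (L.dual.split i) = (tau L.θs i).eval (L.θs j) := fun i j hj => by
    have h := L.dual.q_split i j
    change L.p j (L.dual.split i) = _ * L.p j (L.w 0) at h
    rw [hn j hj, mul_one] at h
    exact h
  intro i hi
  -- ψ is the split sequence of the dual frame, whose split vectors are τ*_i(B)w_0; ψ_{i+1} is found
  -- by comparing v_i-coordinates.
  suffices h : ψ (i + 1) = φ (i + 1) by rw [← h]; exact hψ i hi
  have h := congrArg (L.p i) (hψ i hi)
  change L.p i (L.A (L.dual.split (i + 1))) = L.p i (L.θ (i + 1) • _ + _) at h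
  rw [map_add, map_smul, map_smul, hz _ _ hi.le, hz _ _ hi.le, eval_tau_eq_zero _ (Nat.lt_succ_self i),
    smul_zero, zero_add] at h
  -- τ*_{i+1}(B)w_0 has no v_j-coordinate for j ≤ i, so row i of A only meets its
  -- v_{i+1}-coordinate.
  have hb : L.p i (L.A (L.dual.split (i + 1)))
      = (tau L.θs (i + 1)).eval (L.θs (i + 1)) * L.p i (L.A (L.v (i + 1))) := by
    rcases i with _ | i
    · rw [L.frame_s.coord_zero_tridiagonal L.tridiag_s, hz _ _ (by omega), hz _ _ (by omega),
        eval_tau_eq_zero _ (Nat.lt_succ_self 0)]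
      ring
    · rw [L.frame_s.coord_succ_tridiagonal L.tridiag_s (by omega), hz _ _ (by omega),
        hz _ _ (by omega), hz _ _ (by omega), eval_tau_eq_zero _ (by omega : i < i + 1 + 1),
        eval_tau_eq_zero _ (by omega : i + 1 < i + 1 + 1)]
      ring
  have hτ : (tau L.θs (i + 1)).eval (L.θs (i + 1)) ≠ 0 :=
    L.dual.eval_tau_self_ne_zero (Nat.succ_le_of_lt hi) le_rfl
  have hτ' : (tau L.θs i).eval (L.θs i) ≠ 0 := L.dual.eval_tau_self_ne_zero hi.le le_rfl
  rw [hb, superdiag_eq hn hφ hi, smul_eq_mul] at h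
  refine mul_right_cancel₀ hτ' ?_
  rw [← h]
  field_simp

/-- The vectors η_{d-k}(A)v_0 and η*_k(B)w_0 are proportional, so inverting the order turns one
split basis into the other. -/
theorem prod_smul_ddown_split (hn : L.IsNormalized) (hϕ : L.ddown.IsSplitSequence ϕ) {k : ℕ}
    (hk : k ≤ d) : (∏ h ∈ Finset.range k, ϕ (d - h)) • L.ddown.split (d - k)
      = L.lead d • L.dual.ddown.split k := by
  rw [← sub_eq_zero]
  refine L.frame_s.ext_zero fun i hi => ?_
  rw [map_sub, map_smul, map_smul, sub_eq_zero, smul_eq_mul, smul_eq_mul,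
    prod_mul_p_ddown_split hn hϕ hi hk]
  have h : L.p i (L.dual.ddown.split k) = (eta d L.θs k).eval (L.θs i) * L.p i (L.w 0) :=
    L.frame_s.coord_aeval _ _ _
  rw [h, hn i hi, mul_one]

/-- The second split sequence is inverted when `A` and `B` are exchanged. -/
theorem IsSplitSequence.dual_ddown (hn : L.IsNormalized) (hϕ : L.ddown.IsSplitSequence ϕ) :
    L.dual.ddown.IsSplitSequence (fun i => ϕ (d + 1 - i)) := by
  intro i hi
  have h1 := prod_smul_ddown_split hn hϕ (Nat.succ_le_of_lt hi)
  have h2 := prod_smul_ddown_split hn hϕ hi.le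
  have h3 := L.ddown.A_split (d - (i + 1))
  rw [show d - (i + 1) + 1 = d - i by omega] at h3
  change L.A (L.ddown.split (d - (i + 1))) = L.θ (d - (d - (i + 1))) • _ + _ at h3
  rw [show d - (d - (i + 1)) = i + 1 by omega] at h3
  change L.A (L.dual.ddown.split (i + 1)) = L.θ (i + 1) • L.dual.ddown.split (i + 1)
    + ϕ (d + 1 - (i + 1)) • L.dual.ddown.split i
  rw [show d + 1 - (i + 1) = d - i by omega]
  refine (smul_right_injective V (L.lead_ne_zero le_rfl)) ?_
  change L.lead d • L.A (L.dual.ddown.split (i + 1)) = L.lead d • (_ + _)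
  rw [← map_smul, smul_add, smul_comm _ (L.θ (i + 1)), smul_comm _ (ϕ (d - i)), ← h1, ← h2,
    map_smul, h3, Nat.succ_eq_add_one, Finset.prod_range_succ, smul_add, smul_smul, smul_smul,
    smul_smul, mul_comm (L.θ (i + 1)), mul_comm (ϕ (d - i))]

end LeonardFrame

/-! ### The simple module of a matrix algebra -/

section SimpleModule

variable {K 𝒜 : Type*} [Field K] [Ring 𝒜] [Algebra K 𝒜] {d : ℕ}
  (V : Type*) [AddCommGroup V] [Module K V] [Module 𝒜 V] [IsScalarTower K 𝒜 V] [IsSimpleModule 𝒜 V]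

/-- A simple module over an algebra isomorphic to `Mat_n(K)` has dimension `n`. -/
theorem finrank_eq_of_algEquiv_matrix {n : ℕ}
    (e : 𝒜 ≃ₐ[K] Matrix (Fin n) (Fin n) K) : Module.finrank K V = n := by
  have := IsSimpleModule.nontrivial 𝒜 V
  let s : Fin n → Fin n → 𝒜 := fun i j => e.symm (Matrix.single i j 1)
  have hs : ∀ i j k l, s i j * s k l = if j = k then s i l else 0 := by
    intro i j k l
    simp only [s, ← map_mul]
    split_ifs with h
    · subst h; simp
    · simp [Matrix.single_mul_single_of_ne _ _ _ _ h]
  have h1 : ∑ i, s i i = 1 := by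
    simp only [s, ← map_sum, Matrix.sum_single_one]
    simp
  -- With matrix units s_ij and s_kk x ≠ 0, the vectors s_ik x are independent and span a submodule,
  -- which is V by simplicity.
  obtain ⟨x, hx⟩ := exists_ne (0 : V)
  obtain ⟨k, hk⟩ : ∃ k, s k k • x ≠ 0 := by
    by_contra! h
    apply hx
    rw [← one_smul 𝒜 x, ← h1, Finset.sum_smul]
    exact Finset.sum_eq_zero fun i _ => h i
  let y : Fin n → V := fun i => s i k • x
  have hsy : ∀ i j l, s i j • y l = if j = l then y i else 0 := by
    intro i j l
    simp only [y, smul_smul, hs]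
    split_ifs <;> simp
  have hli : LinearIndependent K y := by
    rw [Fintype.linearIndependent_iff]
    intro g hg i
    have h := congrArg (s k i • ·) hg
    simp only [Finset.smul_sum, smul_zero, smul_comm _ (g _) (_ : V), hsy] at h
    simpa [hk, y] using h
  have hspan : ∀ a : 𝒜, ∀ z ∈ Submodule.span K (Set.range y),
      a • z ∈ Submodule.span K (Set.range y) := by
    intro a z hz
    induction hz using Submodule.span_induction with
    | mem z hz =>
      obtain ⟨l, rfl⟩ := hz
      have ha : a = ∑ i, ∑ j, (e a i j) • s i j := by
        apply e.injective
        conv_lhs => rw [Matrix.matrix_eq_sum_single (e a)]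
        simp [s, Matrix.smul_single]
      rw [ha]
      simp only [Finset.sum_smul, smul_assoc, hsy]
      refine Submodule.sum_mem _ fun i _ => Submodule.sum_mem _ fun j _ => Submodule.smul_mem _ _ ?_
      split_ifs
      · exact Submodule.subset_span ⟨i, rfl⟩
      · exact zero_mem _
    | zero => simp
    | add z z' _ _ h h' => rw [smul_add]; exact add_mem h h'
    | smul t z _ h => rw [smul_comm]; exact Submodule.smul_mem _ _ h
  let W : Submodule 𝒜 V :=
    { carrier := Submodule.span K (Set.range y)
      add_mem' := add_mem
      zero_mem' := zero_mem _
      smul_mem' := fun a z hz => hspan a z hz }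
  have hW : W = ⊤ := by
    refine (eq_bot_or_eq_top W).resolve_left fun h => hk ?_
    have : s k k • x ∈ W := Submodule.subset_span ⟨k, rfl⟩
    rwa [h, Submodule.mem_bot] at this
  have htop : ⊤ ≤ Submodule.span K (Set.range y) := by
    intro z _
    have : z ∈ W := hW ▸ Submodule.mem_top
    exact this
  rw [Module.finrank_eq_card_basis (Module.Basis.mk hli htop), Fintype.card_fin]

theorem lsmul_injective_of_algEquiv_matrix
    (e : 𝒜 ≃ₐ[K] Matrix (Fin (d + 1)) (Fin (d + 1)) K) :
    Function.Injective (Algebra.lsmul K K V : 𝒜 →ₐ[K] Module.End K V) := by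
  have := IsSimpleModule.nontrivial 𝒜 V
  have : IsSimpleRing 𝒜 := IsSimpleRing.of_ringEquiv e.symm.toRingEquiv inferInstance
  exact RingHom.injective (Algebra.lsmul K K V : 𝒜 →ₐ[K] Module.End K V).toRingHom

/-- The action is faithful because the algebra is simple, and both sides have dimension (d + 1)². -/
theorem lsmul_bijective_of_algEquiv_matrix
    (e : 𝒜 ≃ₐ[K] Matrix (Fin (d + 1)) (Fin (d + 1)) K) :
    Function.Bijective (Algebra.lsmul K K V : 𝒜 →ₐ[K] Module.End K V) := by
  have hinj := lsmul_injective_of_algEquiv_matrix V e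
  have hV := finrank_eq_of_algEquiv_matrix V e
  have : FiniteDimensional K V := FiniteDimensional.of_finrank_pos (by omega)
  have : FiniteDimensional K 𝒜 := Module.Finite.equiv e.toLinearEquiv.symm
  refine ⟨hinj, (LinearMap.injective_iff_surjective_of_finrank_eq_finrank
    (f := (Algebra.lsmul K K V : 𝒜 →ₐ[K] Module.End K V).toLinearMap) ?_).1 hinj⟩
  rw [e.toLinearEquiv.finrank_eq, Module.finrank_linearMap, Module.finrank_matrix, hV]
  simp

end SimpleModule

/-! ### From primitive idempotents to eigenbases -/

section IdempotentBasis

variable {K 𝒜 : Type*} [Field K] [Ring 𝒜] [Algebra K 𝒜] {d : ℕ}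
  {V : Type*} [AddCommGroup V] [Module K V] [Module 𝒜 V] [IsScalarTower K 𝒜 V]

/-- The elements `E_i` act on `V` as the coordinate projections of the basis `w`. -/
def IsIdempotentBasis (E : Fin (d + 1) → 𝒜) (w : Module.Basis (Fin (d + 1)) K V) : Prop :=
  ∀ i j, E i • w j = if i = j then w j else 0

theorem smul_eq_lsmul (a : 𝒜) (x : V) : a • x = Algebra.lsmul K K V a x := rfl

theorem IsIdempotentBasis.smul_eq {E : Fin (d + 1) → 𝒜} {w : Module.Basis (Fin (d + 1)) K V}
    (h : IsIdempotentBasis E w) (i : Fin (d + 1)) (x : V) : E i • x = w.coord i x • w i := by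
  conv_lhs => rw [← w.sum_repr x, Finset.smul_sum]
  rw [Finset.sum_eq_single i]
  · rw [smul_comm, h, if_pos rfl, w.coord_apply]
  · intro j _ hj
    rw [smul_comm, h, if_neg hj.symm, smul_zero]
  · simp

theorem IsIdempotentBasis.smul_smul {E : Fin (d + 1) → 𝒜} {w : Module.Basis (Fin (d + 1)) K V}
    (h : IsIdempotentBasis E w) (i j : Fin (d + 1)) (x : V) :
    E i • E j • x = if i = j then E j • x else 0 := by
  rw [h.smul_eq j, smul_comm, h]
  split_ifs <;> simp

/-- E_i Y E_j acts as the (i, j) entry of Y times a matrix unit; faithfulness brings the vanishing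
back to the algebra. -/
theorem IsIdempotentBasis.mul_mul_eq_zero_iff
    (hinj : Function.Injective (Algebra.lsmul K K V : 𝒜 →ₐ[K] Module.End K V))
    {E : Fin (d + 1) → 𝒜} {w : Module.Basis (Fin (d + 1)) K V}
    (h : IsIdempotentBasis E w) (Y : 𝒜) (i j : Fin (d + 1)) :
    E i * Y * E j = 0 ↔ w.coord i (Y • w j) = 0 := by
  constructor
  · intro h0
    have h1 : (E i * Y * E j) • w j = 0 := by rw [h0, zero_smul]
    rw [mul_smul, mul_smul, h, if_pos rfl, h.smul_eq] at h1
    exact (smul_eq_zero.1 h1).resolve_right (w.ne_zero i)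
  · intro h0
    apply hinj
    rw [map_zero]
    ext x
    rw [← smul_eq_lsmul, mul_smul, mul_smul, h.smul_eq j, smul_comm Y, h.smul_eq i,
      map_smul, h0]
    simp

theorem IsIdempotentBasis.trace_mul {E : Fin (d + 1) → 𝒜}
    {w : Module.Basis (Fin (d + 1)) K V} (h : IsIdempotentBasis E w) (Y : 𝒜) (i : Fin (d + 1)) :
    LeonardSystem.tr V (E i * Y) = w.coord i (Y • w i) := by
  rw [LeonardSystem.tr, LinearMap.trace_eq_matrix_trace K w, Matrix.trace, Finset.sum_eq_single i]
  · rw [Matrix.diag_apply, LinearMap.toMatrix_apply, ← smul_eq_lsmul, mul_smul, h.smul_eq]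
    simp
  · intro j _ hj
    rw [Matrix.diag_apply, LinearMap.toMatrix_apply, ← smul_eq_lsmul, mul_smul, h.smul_eq]
    simp [hj.symm]
  · simp

theorem IsIdempotentBasis.isUnitSMul {E : Fin (d + 1) → 𝒜} {w : Module.Basis (Fin (d + 1)) K V}
    (h : IsIdempotentBasis E w) {t : Fin (d + 1) → K} (ht : ∀ i, IsUnit (t i)) :
    IsIdempotentBasis E (w.isUnitSMul ht) := by
  intro i j
  rw [w.isUnitSMul_apply, smul_comm, h]
  split_ifs <;> simp

theorem IsPrimitiveIdempotentOrdering.exists_basis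
    (hbij : Function.Bijective (Algebra.lsmul K K V : 𝒜 →ₐ[K] Module.End K V))
    (hV : Module.finrank K V = d + 1) {X : 𝒜} {θ : Fin (d + 1) → K} {E : Fin (d + 1) → 𝒜}
    (h : IsPrimitiveIdempotentOrdering X θ E) :
    ∃ w : Module.Basis (Fin (d + 1)) K V, IsIdempotentBasis E w ∧ ∀ i, X • w i = θ i • w i := by
  have : FiniteDimensional K V := FiniteDimensional.of_finrank_pos (by omega)
  set f : Module.End K V := Algebra.lsmul K K V X with hf
  have hs : spectrum K f = spectrum K X :=
    AlgEquiv.spectrum_eq (AlgEquiv.ofBijective (Algebra.lsmul K K V) hbij) X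
  have hev : ∀ i, ∃ x, f.HasEigenvector (θ i) x := fun i => by
    have : θ i ∈ spectrum K f := by rw [hs, ← h.range_eq]; exact ⟨i, rfl⟩
    exact (Module.End.hasEigenvalue_iff_mem_spectrum.2 this).exists_hasEigenvector
  choose x hx using hev
  have hli : LinearIndependent K x :=
    Module.End.eigenvectors_linearIndependent' f θ h.injective x hx
  refine ⟨basisOfLinearIndependentOfCardEqFinrank hli (by simp [hV]), fun i j => ?_, fun i => ?_⟩
  -- E_i is the Lagrange polynomial at θ_i evaluated at X, so on an eigenvector for θ_j it is the
  -- scalar δ_ij.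
  · rw [coe_basisOfLinearIndependentOfCardEqFinrank, h.idempotent_eq, smul_eq_lsmul (K := K),
      ← Polynomial.aeval_algHom_apply, ← hf, Module.End.aeval_apply_of_hasEigenvector (hx j),
      Polynomial.eval_prod]
    simp only [Polynomial.eval_mul, Polynomial.eval_C, Polynomial.eval_sub, Polynomial.eval_X]
    split_ifs with hij
    · subst hij
      rw [Finset.prod_eq_one, one_smul]
      intro k hk
      exact inv_mul_cancel₀ (sub_ne_zero.2 fun e => (Finset.ne_of_mem_erase hk) (h.injective e).symm)
    · rw [Finset.prod_eq_zero (Finset.mem_erase.2 ⟨Ne.symm hij, Finset.mem_univ j⟩), zero_smul]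
      rw [sub_self, mul_zero]
  · rw [coe_basisOfLinearIndependentOfCardEqFinrank]
    exact (hx i).apply_eq_smul

theorem IsPrimitiveIdempotentOrdering.smul_eq
    (hbij : Function.Bijective (Algebra.lsmul K K V : 𝒜 →ₐ[K] Module.End K V))
    (hV : Module.finrank K V = d + 1) {X : 𝒜} {θ : Fin (d + 1) → K} {E : Fin (d + 1) → 𝒜}
    (h : IsPrimitiveIdempotentOrdering X θ E) {w : Module.Basis (Fin (d + 1)) K V}
    (hw : IsIdempotentBasis E w) (i : Fin (d + 1)) : X • w i = θ i • w i := by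
  obtain ⟨w', hw', hX⟩ := h.exists_basis hbij hV
  have e : w i = w'.coord i (w i) • w' i := by
    rw [← hw'.smul_eq, hw, if_pos rfl]
  rw [e, smul_comm, hX, smul_comm]

/-- `eigenvalue` is an arbitrary choice from an existence statement; uniqueness identifies the
choice made for `ddown` with the reversed sequence. -/
theorem IsPrimitiveIdempotentOrdering.eigenvalue_unique
    (hbij : Function.Bijective (Algebra.lsmul K K V : 𝒜 →ₐ[K] Module.End K V))
    (hV : Module.finrank K V = d + 1) {X : 𝒜} {θ θ' : Fin (d + 1) → K} {E : Fin (d + 1) → 𝒜}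
    (h : IsPrimitiveIdempotentOrdering X θ E) (h' : IsPrimitiveIdempotentOrdering X θ' E) :
    θ = θ' := by
  obtain ⟨w, hw, hX⟩ := h.exists_basis hbij hV
  funext i
  have := h'.smul_eq hbij hV hw i
  rw [hX] at this
  exact smul_left_injective K (w.ne_zero i) this

/-- The vectors of a basis as a sequence, continued by zero. -/
noncomputable def vecSeq (w : Module.Basis (Fin (d + 1)) K V) (i : ℕ) : V :=
  if h : i < d + 1 then w ⟨i, h⟩ else 0

/-- The coordinate functionals of a basis as a sequence, continued by zero. -/
noncomputable def coordSeq (w : Module.Basis (Fin (d + 1)) K V) (i : ℕ) : Module.Dual K V :=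
  if h : i < d + 1 then w.coord ⟨i, h⟩ else 0

theorem vecSeq_of_lt (w : Module.Basis (Fin (d + 1)) K V) {i : ℕ} (h : i < d + 1) :
    vecSeq w i = w ⟨i, h⟩ := dif_pos h

theorem coordSeq_of_lt (w : Module.Basis (Fin (d + 1)) K V) {i : ℕ} (h : i < d + 1) :
    coordSeq w i = w.coord ⟨i, h⟩ := dif_pos h

theorem isEigenframe_of_basis {X : Module.End K V} {θ : ℕ → K}
    (hθ : Function.Injective fun i : Fin (d + 1) => θ i) {w : Module.Basis (Fin (d + 1)) K V}
    (hw : ∀ i, X (w i) = θ i • w i) : IsEigenframe d X θ (vecSeq w) (coordSeq w) where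
  inj i hi j hj hij := by
    have := hθ (a₁ := ⟨i, by omega⟩) (a₂ := ⟨j, by omega⟩) hij
    simpa using this
  coord_self i hi := by
    rw [vecSeq_of_lt w (by omega), coordSeq_of_lt w (by omega)]
    simp
  coord_ne i hi j hj hij := by
    rw [vecSeq_of_lt w (by omega), coordSeq_of_lt w (by omega)]
    simp [Ne.symm hij]
  coord_zero i hi := dif_neg (by omega)
  sum_coord x := by
    rw [← Fin.sum_univ_eq_sum_range (fun i => coordSeq w i x • vecSeq w i)]
    conv_rhs => rw [← w.sum_repr x]
    refine Finset.sum_congr rfl fun i _ => ?_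
    rw [vecSeq_of_lt w i.isLt, coordSeq_of_lt w i.isLt, w.coord_apply]
  map_eq i hi := by
    rw [vecSeq_of_lt w (by omega)]
    exact hw _

theorem isIrreducibleTridiagonal_of_basis
    (hinj : Function.Injective (Algebra.lsmul K K V : 𝒜 →ₐ[K] Module.End K V))
    {E : Fin (d + 1) → 𝒜} {w : Module.Basis (Fin (d + 1)) K V} (hw : IsIdempotentBasis E w) {Y : 𝒜}
    (hfar : ∀ i j : Fin (d + 1), 1 < |(i : ℤ) - (j : ℤ)| → E i * Y * E j = 0)
    (hnear : ∀ i j : Fin (d + 1), |(i : ℤ) - (j : ℤ)| = 1 → E i * Y * E j ≠ 0) :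
    IsIrreducibleTridiagonal d (Algebra.lsmul K K V Y) (vecSeq w) (coordSeq w) where
  far_up i hi j hj hij := by
    rw [vecSeq_of_lt w (by omega), coordSeq_of_lt w (by omega), ← smul_eq_lsmul,
      ← hw.mul_mul_eq_zero_iff hinj]
    refine hfar _ _ (lt_abs.2 (Or.inr ?_))
    push_cast
    omega
  far_down i hi j hj hij := by
    rw [vecSeq_of_lt w (by omega), coordSeq_of_lt w (by omega), ← smul_eq_lsmul,
      ← hw.mul_mul_eq_zero_iff hinj]
    refine hfar _ _ (lt_abs.2 (Or.inl ?_))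
    push_cast
    omega
  up i hi := by
    rw [vecSeq_of_lt w (by omega), coordSeq_of_lt w (by omega), ← smul_eq_lsmul, Ne,
      ← hw.mul_mul_eq_zero_iff hinj]
    refine hnear _ _ ?_
    push_cast
    simp
  down i hi := by
    rw [vecSeq_of_lt w (by omega), coordSeq_of_lt w (by omega), ← smul_eq_lsmul, Ne,
      ← hw.mul_mul_eq_zero_iff hinj]
    refine hnear _ _ ?_
    push_cast
    simp

end IdempotentBasis

/-! ### Transfer between frames and Leonard systems -/

section Bridge

variable {K 𝒜 : Type*} [Field K] [Ring 𝒜] [Algebra K 𝒜] {d : ℕ}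
  {V : Type*} [AddCommGroup V] [Module K V] [Module 𝒜 V] [IsScalarTower K 𝒜 V]

/-- The frame `L` describes the action of the Leonard system `Φ` on `V`. -/
structure LeonardFrame.Represents (L : LeonardFrame K V d) (Φ : LeonardSystem K 𝒜 d) : Prop where
  A_eq : L.A = Algebra.lsmul K K V Φ.A
  B_eq : L.B = Algebra.lsmul K K V Φ.As
  θ_eq : ∀ i : Fin (d + 1), L.θ i = Φ.eigenvalue i
  θs_eq : ∀ i : Fin (d + 1), L.θs i = Φ.dualEigenvalue i

namespace LeonardFrame.Represents

variable {L : LeonardFrame K V d} {Φ : LeonardSystem K 𝒜 d}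

theorem dual (h : L.Represents Φ) : L.dual.Represents Φ.dual where
  A_eq := h.B_eq
  B_eq := h.A_eq
  θ_eq := h.θs_eq
  θs_eq := h.θ_eq

theorem ddown (hbij : Function.Bijective (Algebra.lsmul K K V : 𝒜 →ₐ[K] Module.End K V))
    (hV : Module.finrank K V = d + 1) (h : L.Represents Φ) : L.ddown.Represents Φ.ddown where
  A_eq := h.A_eq
  B_eq := h.B_eq
  θ_eq i := by
    have e := Φ.ddown.eigenvalue_spec.eigenvalue_unique hbij hV Φ.eigenvalue_spec.rev
    rw [e]
    change L.θ (d - i) = Φ.eigenvalue i.rev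
    rw [← h.θ_eq, Fin.val_rev, Nat.add_sub_add_right]
  θs_eq := h.θs_eq

theorem A_smul (h : L.Represents Φ) (i : Fin (d + 1)) (x : V) :
    (Φ.A - algebraMap K 𝒜 (Φ.eigenvalue i)) • x = L.A x - L.θ i • x := by
  rw [sub_smul, algebraMap_smul, h.A_eq, h.θ_eq, Algebra.lsmul_coe]

theorem As_smul (h : L.Represents Φ) (i : Fin (d + 1)) (x : V) :
    (Φ.As - algebraMap K 𝒜 (Φ.dualEigenvalue i)) • x = L.B x - L.θs i • x := by
  rw [sub_smul, algebraMap_smul, h.B_eq, h.θs_eq, Algebra.lsmul_coe]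

theorem A_smul_split (h : L.Represents Φ) (i : Fin (d + 1)) :
    (Φ.A - algebraMap K 𝒜 (Φ.eigenvalue i)) • L.split i = L.split (i + 1) := by
  rw [h.A_smul, L.split_succ]

/-- U_0 lies in the θ*_0-eigenspace of B, a line spanned by v_0; the raising condition then carries
τ_i(A)v_0 into U_i. Hence the decomposition is forced. -/
theorem split_mem (h : L.Represents Φ) {U : Fin (d + 1) → Submodule K V}
    (hU : Φ.IsSplitDecomposition U) (i : Fin (d + 1)) : L.split i ∈ U i := by
  induction i using Fin.induction with
  | zero =>
    have : Nontrivial (U 0) := Module.nontrivial_of_finrank_pos (R := K) (by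
      rw [hU.finrank_eq_one]; exact one_pos)
    obtain ⟨⟨e, he⟩, he0⟩ := exists_ne (0 : U 0)
    have h1 := hU.lower_zero e he
    rw [h.As_smul, sub_eq_zero] at h1
    have h2 := L.frame_s.eq_smul_of_map_eq (Nat.zero_le d) h1
    have h3 : L.p 0 e ≠ 0 := by
      intro h3
      rw [h3, zero_smul] at h2
      exact he0 (Subtype.ext h2)
    have h4 : L.v 0 = (L.p 0 e)⁻¹ • e := by
      conv_rhs => rw [h2]
      simp [smul_smul, L.frame_s.coord_self 0 (Nat.zero_le d), h3]
    rw [Fin.val_zero, L.split_zero, h4]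
    exact Submodule.smul_mem _ _ he
  | succ i ih =>
    have := hU.raise i _ ih
    rwa [h.A_smul_split] at this

theorem isSplitDecomposition (h : L.Represents Φ) (hV : Module.finrank K V = d + 1) {φ : ℕ → K}
    (hφ : L.IsSplitSequence φ) :
    Φ.IsSplitDecomposition (V := V) (fun i => Submodule.span K {L.split i}) := by
  have hspan : ⊤ ≤ Submodule.span K (Set.range fun i : Fin (d + 1) => L.split i) := by
    intro x _
    have := L.mem_span_split (d + 1) le_rfl x (fun j h1 h2 => by omega)
    refine Submodule.span_mono ?_ this
    rintro _ ⟨i, hi, rfl⟩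
    exact ⟨⟨i, hi⟩, rfl⟩
  have hli := linearIndependent_of_top_le_span_of_card_eq_finrank hspan (by simp [hV])
  refine ⟨fun i => finrank_span_singleton (L.split_ne_zero (by omega)), ?_, ?_, ?_, ?_, ?_⟩
  · refine DirectSum.isInternal_submodule_of_iSupIndep_of_iSup_eq_top
      hli.iSupIndep_span_singleton ?_
    rw [← Submodule.span_range_eq_iSup]
    exact top_le_iff.1 hspan
  · intro i u hu
    obtain ⟨t, rfl⟩ := Submodule.mem_span_singleton.1 hu
    rw [smul_comm, h.A_smul_split]
    exact Submodule.smul_mem _ _ (Submodule.mem_span_singleton_self _)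
  · intro u hu
    obtain ⟨t, rfl⟩ := Submodule.mem_span_singleton.1 hu
    rw [smul_comm, h.A_smul_split, Fin.val_last, L.split_last_succ, smul_zero]
  · intro i u hu
    obtain ⟨t, rfl⟩ := Submodule.mem_span_singleton.1 hu
    rw [smul_comm, h.As_smul, Fin.val_succ, hφ i i.isLt, add_sub_cancel_left]
    exact Submodule.smul_mem _ _ (Submodule.smul_mem _ _ (Submodule.mem_span_singleton_self _))
  · intro u hu
    obtain ⟨t, rfl⟩ := Submodule.mem_span_singleton.1 hu
    rw [smul_comm, h.As_smul, Fin.val_zero, L.split_zero, L.frame_s.map_eq 0 (Nat.zero_le d),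
      sub_self, smul_zero]

theorem isFirstSplitSequence_iff (h : L.Represents Φ) (hV : Module.finrank K V = d + 1)
    {φ : ℕ → K} : Φ.IsFirstSplitSequence V φ ↔
      φ 0 = 0 ∧ φ (d + 1) = 0 ∧ L.IsSplitSequence φ := by
  refine and_congr_right fun _ => and_congr_right fun _ => ⟨?_, fun hφ => ?_⟩
  · rintro ⟨U, hU, hφ⟩ i hi
    obtain ⟨t, ht⟩ := L.exists_B_split_succ hi
    have h1 := hφ ⟨i, hi⟩ _ (h.split_mem hU (Fin.succ ⟨i, hi⟩))
    rw [mul_smul, h.As_smul, Fin.val_succ, ht, add_sub_cancel_left, smul_comm] at h1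
    have h2 := h.A_smul_split (Fin.castSucc ⟨i, hi⟩)
    rw [Fin.val_castSucc] at h2
    rw [h2] at h1
    rwa [smul_left_injective K (L.split_ne_zero (Nat.succ_le_of_lt hi)) h1] at ht
  · refine ⟨_, h.isSplitDecomposition hV hφ, fun i u hu => ?_⟩
    obtain ⟨t, rfl⟩ := Submodule.mem_span_singleton.1 hu
    rw [mul_smul, smul_comm _ t, h.As_smul, Fin.val_succ, hφ i i.isLt, add_sub_cancel_left,
      smul_comm _ t, smul_comm _ (φ _), smul_comm (φ _) t]
    congr 2
    exact h.A_smul_split i.castSucc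

end LeonardFrame.Represents

/-! ### The scalars of a Leonard system -/

namespace LeonardSystem

/-- The frame given by bases `w`, `v` of `V` on which the `E_i`, respectively the `E*_i`, act as
coordinate projections. -/
noncomputable def frame (Φ : LeonardSystem K 𝒜 d)
    (hbij : Function.Bijective (Algebra.lsmul K K V : 𝒜 →ₐ[K] Module.End K V))
    (hV : Module.finrank K V = d + 1) {θ θs : ℕ → K}
    (hθ : ∀ i : Fin (d + 1), θ i = Φ.eigenvalue i)
    (hθs : ∀ i : Fin (d + 1), θs i = Φ.dualEigenvalue i)
    {w v : Module.Basis (Fin (d + 1)) K V} (hw : IsIdempotentBasis Φ.E w)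
    (hv : IsIdempotentBasis Φ.Es v) : LeonardFrame K V d where
  A := Algebra.lsmul K K V Φ.A
  B := Algebra.lsmul K K V Φ.As
  θ := θ
  θs := θs
  w := vecSeq w
  q := coordSeq w
  v := vecSeq v
  p := coordSeq v
  frame := isEigenframe_of_basis
    (by simp only [hθ]; exact Φ.eigenvalue_spec.injective)
    (fun i => by rw [hθ]; exact Φ.eigenvalue_spec.smul_eq hbij hV hw i)
  frame_s := isEigenframe_of_basis
    (by simp only [hθs]; exact Φ.dual.eigenvalue_spec.injective)
    (fun i => by rw [hθs]; exact Φ.dual.eigenvalue_spec.smul_eq hbij hV hv i)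
  tridiag := isIrreducibleTridiagonal_of_basis hbij.1 hw Φ.zero_far Φ.ne_zero_near
  tridiag_s := isIrreducibleTridiagonal_of_basis hbij.1 hv Φ.zero_far_s Φ.ne_zero_near_s

variable (Φ : LeonardSystem K 𝒜 d)
  (hbij : Function.Bijective (Algebra.lsmul K K V : 𝒜 →ₐ[K] Module.End K V))
  (hV : Module.finrank K V = d + 1) {θ θs φ ϕ : ℕ → K}
  (hθ : ∀ i : Fin (d + 1), θ i = Φ.eigenvalue i)
  (hθs : ∀ i : Fin (d + 1), θs i = Φ.dualEigenvalue i)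
  {w v : Module.Basis (Fin (d + 1)) K V} (hw : IsIdempotentBasis Φ.E w)
  (hv : IsIdempotentBasis Φ.Es v)

theorem frame_represents : (Φ.frame hbij hV hθ hθs hw hv).Represents Φ := ⟨rfl, rfl, hθ, hθs⟩

theorem exists_eigenvalue_seq : ∃ θ : ℕ → K, ∀ i : Fin (d + 1), θ i = Φ.eigenvalue i :=
  ⟨fun i => if h : i < d + 1 then Φ.eigenvalue ⟨i, h⟩ else 0, fun i => dif_pos i.isLt⟩

include hw hv in
theorem frame_isNormalized (h : ∀ i, v i = Φ.Es i • w 0) :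
    (Φ.frame hbij hV hθ hθs hw hv).IsNormalized := by
  intro i hi
  change coordSeq v i (vecSeq w 0) = 1
  rw [coordSeq_of_lt v (by omega), vecSeq_of_lt w (by omega)]
  have h1 := h ⟨i, by omega⟩
  rw [hv.smul_eq] at h1
  have h2 := congrArg (v.coord ⟨i, by omega⟩) h1
  rw [map_smul] at h2
  simpa using h2.symm

include hbij hV in
theorem exists_idempotentBasis :
    ∃ w : Module.Basis (Fin (d + 1)) K V, IsIdempotentBasis Φ.E w :=
  (Φ.eigenvalue_spec.exists_basis hbij hV).imp fun _ h => h.1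

-- Each v_i is rescaled by p_i(w_0), which is nonzero by `p_w_zero_ne_zero`.
include hbij hV in
theorem exists_normalized_bases : ∃ w v : Module.Basis (Fin (d + 1)) K V,
    IsIdempotentBasis Φ.E w ∧ IsIdempotentBasis Φ.Es v ∧ ∀ i, v i = Φ.Es i • w 0 := by
  obtain ⟨θ, hθ⟩ := Φ.exists_eigenvalue_seq
  obtain ⟨θs, hθs⟩ := Φ.dual.exists_eigenvalue_seq
  obtain ⟨w, hw⟩ := Φ.exists_idempotentBasis hbij hV
  obtain ⟨v, hv⟩ := Φ.dual.exists_idempotentBasis hbij hV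
  have ht : ∀ i, IsUnit (v.coord i (w 0)) := fun i => by
    have := (Φ.frame hbij hV hθ hθs hw hv).p_w_zero_ne_zero (i := i) (by omega)
    change coordSeq v i (vecSeq w 0) ≠ 0 at this
    rw [coordSeq_of_lt v i.isLt, vecSeq_of_lt w (by omega)] at this
    exact isUnit_iff_ne_zero.2 this
  refine ⟨w, v.isUnitSMul ht, hw, IsIdempotentBasis.isUnitSMul hv ht, fun i => ?_⟩
  rw [v.isUnitSMul_apply]
  exact (IsIdempotentBasis.smul_eq hv i (w 0)).symm

-- A vector u of E_0 V is a multiple of w_0; scaling every w_i by that factor makes u = w_0, so the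
-- given standard basis is normalized.
include hbij hV in
theorem IsStandardBasis.exists_basis (h : Φ.IsStandardBasis v) :
    ∃ w : Module.Basis (Fin (d + 1)) K V,
      IsIdempotentBasis Φ.E w ∧ IsIdempotentBasis Φ.Es v ∧ ∀ i, v i = Φ.Es i • w 0 := by
  obtain ⟨u, hu, ⟨x, hx⟩, hvu⟩ := h
  obtain ⟨w, hw⟩ := Φ.exists_idempotentBasis hbij hV
  obtain ⟨v', hv'⟩ := Φ.dual.exists_idempotentBasis hbij hV
  rw [hw.smul_eq] at hx
  have ht : IsUnit (w.coord 0 x) := isUnit_iff_ne_zero.2 fun h0 => hu (by rw [hx, h0, zero_smul])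
  refine ⟨w.isUnitSMul fun _ => ht, hw.isUnitSMul _, fun i j => ?_, fun i => ?_⟩
  · rw [hvu]
    exact IsIdempotentBasis.smul_smul hv' i j u
  · rw [w.isUnitSMul_apply, ← hx, hvu]

include hbij hV in
theorem exists_isParameterArray : ∃ θ θs φ ϕ : ℕ → K, Φ.IsParameterArray V θ θs φ ϕ := by
  obtain ⟨θ, hθ⟩ := Φ.exists_eigenvalue_seq
  obtain ⟨θs, hθs⟩ := Φ.dual.exists_eigenvalue_seq
  obtain ⟨w, v, hw, hv, -⟩ := Φ.exists_normalized_bases hbij hV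
  have hL := Φ.frame_represents hbij hV hθ hθs hw hv
  obtain ⟨φ, h1, h2, h3⟩ := (Φ.frame hbij hV hθ hθs hw hv).exists_isSplitSequence
  obtain ⟨ϕ, h4, h5, h6⟩ := (Φ.frame hbij hV hθ hθs hw hv).ddown.exists_isSplitSequence
  exact ⟨θ, θs, φ, ϕ, hθ, hθs, (hL.isFirstSplitSequence_iff hV).2 ⟨h2, h3, h1⟩,
    ((hL.ddown hbij hV).isFirstSplitSequence_iff hV).2 ⟨h5, h6, h4⟩⟩

include hbij hV in
theorem exists_isStandardBasis :
    ∃ v : Module.Basis (Fin (d + 1)) K V, Φ.IsStandardBasis v := by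
  obtain ⟨w, v, hw, hv, h⟩ := Φ.exists_normalized_bases hbij hV
  exact ⟨v, w 0, w.ne_zero 0, ⟨w 0, by rw [hw, if_pos rfl]⟩, h⟩

variable {Φ}

include hbij hV in
theorem IsParameterArray.dual (h : Φ.IsParameterArray V θ θs φ ϕ) :
    Φ.dual.IsParameterArray V θs θ φ (fun i => ϕ (d + 1 - i)) := by
  obtain ⟨w, v, hw, hv, hwv⟩ := Φ.exists_normalized_bases hbij hV
  have hL := Φ.frame_represents hbij hV h.eigenvalue_eq h.dualEigenvalue_eq hw hv
  have hn := Φ.frame_isNormalized hbij hV h.eigenvalue_eq h.dualEigenvalue_eq hw hv hwv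
  obtain ⟨h1, h2, h3⟩ := (hL.isFirstSplitSequence_iff hV).1 h.firstSplit
  obtain ⟨h4, h5, h6⟩ := ((hL.ddown hbij hV).isFirstSplitSequence_iff hV).1 h.secondSplit
  exact ⟨h.dualEigenvalue_eq, h.eigenvalue_eq,
    (hL.dual.isFirstSplitSequence_iff hV).2 ⟨h1, h2, h3.dual hn⟩,
    ((hL.dual.ddown hbij hV).isFirstSplitSequence_iff hV).2
      ⟨by simpa using h5, by simpa using h4, h6.dual_ddown hn⟩⟩

include hw hv in
theorem trace_E_mul_Es (i j : Fin (d + 1)) :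
    tr V (Φ.E i * Φ.Es j) = w.coord i (v j) * v.coord j (w i) := by
  rw [hw.trace_mul, hv.smul_eq, map_smul, smul_eq_mul, mul_comm]

include hw hv in
theorem trace_Es_mul_E (i j : Fin (d + 1)) :
    tr V (Φ.Es i * Φ.E j) = w.coord j (v i) * v.coord i (w j) := by
  rw [hv.trace_mul, hw.smul_eq, map_smul, smul_eq_mul]

include hv in
theorem coord_w_zero_of_eq (h : ∀ i, v i = Φ.Es i • w 0) (i : Fin (d + 1)) :
    v.coord i (w 0) = 1 := by
  have h2 := congrArg (v.coord i) (h i)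
  rw [hv.smul_eq, map_smul] at h2
  simpa using h2.symm

include hw hv in
theorem m_zero_eq (h : ∀ i, v i = Φ.Es i • w 0) : Φ.m V 0 = w.coord 0 (v 0) := by
  rw [m, trace_E_mul_Es hw hv, coord_w_zero_of_eq hv h, mul_one]

include hbij hV in
theorem m_zero_ne_zero : Φ.m V 0 ≠ 0 := by
  obtain ⟨θ, hθ⟩ := Φ.exists_eigenvalue_seq
  obtain ⟨θs, hθs⟩ := Φ.dual.exists_eigenvalue_seq
  obtain ⟨w, v, hw, hv, h⟩ := Φ.exists_normalized_bases hbij hV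
  have := (Φ.frame hbij hV hθ hθs hw hv).q_v_zero_ne_zero (Nat.zero_le d)
  change coordSeq w 0 (vecSeq v 0) ≠ 0 at this
  rw [coordSeq_of_lt w (by omega), vecSeq_of_lt v (by omega)] at this
  rwa [m_zero_eq hw hv h]

/-- Symmetry of the trace: ν is the same for Φ and Φ*. -/
theorem dual_m_zero : Φ.dual.m V 0 = Φ.m V 0 := by
  change LinearMap.trace K V (Algebra.lsmul K K V (Φ.Es 0 * Φ.E 0))
    = LinearMap.trace K V (Algebra.lsmul K K V (Φ.E 0 * Φ.Es 0))
  rw [map_mul (Algebra.lsmul K K V), map_mul (Algebra.lsmul K K V), LinearMap.trace_mul_comm]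

include hbij hV in
theorem nu_eq (h : Φ.IsParameterArray V θ θs φ ϕ) :
    Φ.nu V = ((eta d θ d).eval (θ 0) * (eta d θs d).eval (θs 0)) / ∏ j ∈ Finset.Icc 1 d, ϕ j := by
  obtain ⟨w, v, hw, hv, hwv⟩ := Φ.exists_normalized_bases hbij hV
  have hL := Φ.frame_represents hbij hV h.eigenvalue_eq h.dualEigenvalue_eq hw hv
  have hn := Φ.frame_isNormalized hbij hV h.eigenvalue_eq h.dualEigenvalue_eq hw hv hwv
  have h6 := (((hL.ddown hbij hV).isFirstSplitSequence_iff hV).1 h.secondSplit).2.2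
  have h7 := LeonardFrame.q_zero_v_zero_inv hn h6
  change (coordSeq w 0 (vecSeq v 0))⁻¹ = _ at h7
  rw [coordSeq_of_lt w (by omega), vecSeq_of_lt v (by omega)] at h7
  rw [nu, m_zero_eq hw hv hwv, LeonardFrame.prod_Icc_one]
  exact h7

include hbij hV in
theorem k_eq (h : Φ.IsParameterArray V θ θs φ ϕ) (i : Fin (d + 1)) : Φ.k V i =
    ((∏ j ∈ Finset.Icc 1 (i : ℕ), φ j) / ∏ j ∈ Finset.Icc 1 (i : ℕ), ϕ j) *
      ((eta d θs d).eval (θs 0) / ((tau θs i).eval (θs i) * (eta d θs (d - i)).eval (θs i))) := by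
  obtain ⟨w, v, hw, hv, hwv⟩ := Φ.exists_normalized_bases hbij hV
  have hL := Φ.frame_represents hbij hV h.eigenvalue_eq h.dualEigenvalue_eq hw hv
  have hn := Φ.frame_isNormalized hbij hV h.eigenvalue_eq h.dualEigenvalue_eq hw hv hwv
  have h3 := ((hL.isFirstSplitSequence_iff hV).1 h.firstSplit).2.2
  have h6 := (((hL.ddown hbij hV).isFirstSplitSequence_iff hV).1 h.secondSplit).2.2
  have h7 := LeonardFrame.q_zero_v_div hn h3 h6 (i := i) (by omega)
  change coordSeq w 0 (vecSeq v i) * (coordSeq w 0 (vecSeq v 0))⁻¹ = _ at h7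
  rw [coordSeq_of_lt w (by omega), vecSeq_of_lt v i.isLt, vecSeq_of_lt v (by omega)] at h7
  rw [k, nu, m_zero_eq hw hv hwv, LeonardFrame.prod_Icc_one, LeonardFrame.prod_Icc_one]
  have h8 : Φ.dual.m V i = w.coord 0 (v i) := by
    have := trace_Es_mul_E hw hv i 0
    rw [coord_w_zero_of_eq hv hwv, mul_one] at this
    exact this
  rw [h8]
  exact h7

include hbij hV in
theorem IsParameterArray.ne_zero (h : Φ.IsParameterArray V θ θs φ ϕ) {j : ℕ} (h1 : 1 ≤ j)
    (hj : j ≤ d) : φ j ≠ 0 ∧ ϕ j ≠ 0 := by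
  obtain ⟨w, v, hw, hv, hwv⟩ := Φ.exists_normalized_bases hbij hV
  have hL := Φ.frame_represents hbij hV h.eigenvalue_eq h.dualEigenvalue_eq hw hv
  have h3 := ((hL.isFirstSplitSequence_iff hV).1 h.firstSplit).2.2
  have h6 := (((hL.ddown hbij hV).isFirstSplitSequence_iff hV).1 h.secondSplit).2.2
  obtain ⟨j, rfl⟩ : ∃ i, j = i + 1 := ⟨j - 1, by omega⟩
  exact ⟨h3.ne_zero _ hj, h6.ne_zero _ hj⟩

-- Apply the formula for k_i to Φ*: there k*_i = m_i ν, the products of ϕ are reversed, and the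
-- formula for ν removes the factor.
include hbij hV in
theorem m_eq (h : Φ.IsParameterArray V θ θs φ ϕ) (i : Fin (d + 1)) : Φ.m V i =
    ((∏ j ∈ Finset.Icc 1 (i : ℕ), φ j) * ∏ j ∈ Finset.Icc 1 (d - i), ϕ j) /
      ((eta d θs d).eval (θs 0) * ((tau θ i).eval (θ i) * (eta d θ (d - i)).eval (θ i))) := by
  have hd := h.dual hbij hV
  have hk := k_eq hbij hV hd i
  have hν := nu_eq hbij hV h
  have hm0 := m_zero_ne_zero (Φ := Φ) hbij hV
  rw [k, nu, dual_m_zero, ← nu, hν] at hk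
  have hP : ∏ j ∈ Finset.range d, ϕ (j + 1) ≠ 0 := by
    rw [Finset.prod_ne_zero_iff]
    intro j hj
    have := Finset.mem_range.1 hj
    exact (h.ne_zero hbij hV (by omega) (by omega)).2
  have hsplit := LeonardFrame.prod_range_sub_mul_prod_range ϕ (Nat.sub_le d i)
  rw [Nat.sub_sub_self (by omega)] at hsplit
  have hrev : ∏ j ∈ Finset.range (i : ℕ), ϕ (d + 1 - (j + 1)) =
      ∏ j ∈ Finset.range (i : ℕ), ϕ (d - j) :=
    Finset.prod_congr rfl fun j _ => by rw [Nat.add_sub_add_right]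
  rw [LeonardFrame.prod_Icc_one, LeonardFrame.prod_Icc_one, LeonardFrame.prod_Icc_one, hrev] at hk
  rw [LeonardFrame.prod_Icc_one, LeonardFrame.prod_Icc_one]
  rw [nu, LeonardFrame.prod_Icc_one] at hν
  have hν0 := inv_ne_zero hm0
  rw [hν] at hν0
  rw [← hsplit] at hk hP hν0
  obtain ⟨hQ, hR⟩ := mul_ne_zero_iff.1 hP
  -- The η-values at θ_0 and θ*_0 are nonzero because they are factors of the numerator of ν.
  obtain ⟨hη, hηs⟩ := mul_ne_zero_iff.1 (div_ne_zero_iff.1 hν0).1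
  refine mul_right_cancel₀ hν0 ?_
  rw [show Φ.m V i = Φ.dual.dual.m V i from rfl, hk]
  field_simp

theorem repMatrix_apply_eq (X : 𝒜) (i j : Fin (d + 1)) :
    repMatrix v X i j = v.coord i (X • v j) := by
  rw [repMatrix, LinearMap.toMatrix_apply]
  rfl

include hv in
theorem trace_Es_mul_mul_Es_mul (X : 𝒜) (i j : Fin (d + 1)) :
    tr V (Φ.Es i * X * Φ.Es j * X) = v.coord j (X • v i) * v.coord i (X • v j) := by
  rw [mul_assoc, mul_assoc, hv.trace_mul, mul_smul, mul_smul, hv.smul_eq, smul_comm, map_smul,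
    smul_eq_mul]

include hbij hV in
theorem superdiag_eq (h : Φ.IsParameterArray V θ θs φ ϕ) (hw : IsIdempotentBasis Φ.E w)
    (hv : IsIdempotentBasis Φ.Es v) (hwv : ∀ i, v i = Φ.Es i • w 0) {i : ℕ} (hi : i < d) :
    v.coord ⟨i, by omega⟩ (Φ.A • v ⟨i + 1, by omega⟩) = φ (i + 1) * ((tau θs i).eval (θs i) /
      (tau θs (i + 1)).eval (θs (i + 1))) := by
  have hL := Φ.frame_represents hbij hV h.eigenvalue_eq h.dualEigenvalue_eq hw hv
  have hn := Φ.frame_isNormalized hbij hV h.eigenvalue_eq h.dualEigenvalue_eq hw hv hwv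
  have h3 := ((hL.isFirstSplitSequence_iff hV).1 h.firstSplit).2.2
  have h7 := LeonardFrame.superdiag_eq hn h3 hi
  change coordSeq v i (Φ.A • vecSeq v (i + 1)) = _ at h7
  rw [coordSeq_of_lt v (by omega), vecSeq_of_lt v (by omega)] at h7
  exact h7

include hbij hV in
theorem subdiag_eq (h : Φ.IsParameterArray V θ θs φ ϕ) (hw : IsIdempotentBasis Φ.E w)
    (hv : IsIdempotentBasis Φ.Es v) (hwv : ∀ i, v i = Φ.Es i • w 0) {i : ℕ} (hi : i < d) :
    v.coord ⟨i + 1, by omega⟩ (Φ.A • v ⟨i, by omega⟩) = ϕ (i + 1) *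
      ((eta d θs (d - (i + 1))).eval (θs (i + 1)) /
        (eta d θs (d - (i + 1) + 1)).eval (θs i)) := by
  have hL := Φ.frame_represents hbij hV h.eigenvalue_eq h.dualEigenvalue_eq hw hv
  have hn := Φ.frame_isNormalized hbij hV h.eigenvalue_eq h.dualEigenvalue_eq hw hv hwv
  have h6 := (((hL.ddown hbij hV).isFirstSplitSequence_iff hV).1 h.secondSplit).2.2
  have h7 := LeonardFrame.subdiag_eq hn h6 hi
  change coordSeq v (i + 1) (Φ.A • vecSeq v i) = _ at h7
  rw [coordSeq_of_lt v (by omega), vecSeq_of_lt v (by omega)] at h7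
  exact h7

include hbij hV in
theorem a_eq (h : Φ.IsParameterArray V θ θs φ ϕ) (i : Fin (d + 1)) : Φ.a V i = θ i +
    φ i / (θs i - θs (i - 1)) + φ (i + 1) / (θs i - θs (i + 1)) := by
  obtain ⟨w, v, hw, hv, -⟩ := Φ.exists_normalized_bases hbij hV
  have hL := Φ.frame_represents hbij hV h.eigenvalue_eq h.dualEigenvalue_eq hw hv
  obtain ⟨h1, h2, h3⟩ := (hL.isFirstSplitSequence_iff hV).1 h.firstSplit
  have h7 := LeonardFrame.diag_eq h3 h1 h2 (i := i) (by omega)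
  change coordSeq v i (Φ.A • vecSeq v i) = _ at h7
  rw [coordSeq_of_lt v i.isLt, vecSeq_of_lt v i.isLt] at h7
  rw [a, hv.trace_mul]
  exact h7

include hbij hV in
theorem x_eq (h : Φ.IsParameterArray V θ θs φ ϕ) {i : ℕ} (h1 : 1 ≤ i) (hi : i ≤ d) :
    Φ.x V i = φ i * ϕ i * (((tau θs (i - 1)).eval (θs (i - 1)) * (eta d θs (d - i)).eval (θs i)) /
      ((tau θs i).eval (θs i) * (eta d θs (d - i + 1)).eval (θs (i - 1)))) := by
  obtain ⟨w, v, hw, hv, hwv⟩ := Φ.exists_normalized_bases hbij hV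
  obtain ⟨i, rfl⟩ : ∃ j, i = j + 1 := ⟨i - 1, by omega⟩
  rw [x, dif_pos ⟨h1, hi⟩, trace_Es_mul_mul_Es_mul hv]
  simp only [Nat.add_sub_cancel]
  rw [superdiag_eq hbij hV h hw hv hwv hi, subdiag_eq hbij hV h hw hv hwv hi, ← div_mul_div_comm]
  ring

end LeonardSystem

end Bridge

theorem mainTheorem9 {K : Type*} [Field K] {d : ℕ} {𝒜 : Type*} [Ring 𝒜] [Algebra K 𝒜]
    (h𝒜 : Nonempty (𝒜 ≃ₐ[K] Matrix (Fin (d + 1)) (Fin (d + 1)) K))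
    (Φ : LeonardSystem K 𝒜 d)
    (V : Type*) [AddCommGroup V] [Module K V] [Module 𝒜 V] [IsScalarTower K 𝒜 V]
    [IsSimpleModule 𝒜 V] :
    -- the parameter array, the standard basis and the scalar `ν` exist
    (∃ θ θs φ ϕ : ℕ → K, Φ.IsParameterArray V θ θs φ ϕ) ∧
    (∃ v : Module.Basis (Fin (d + 1)) K V, Φ.IsStandardBasis v) ∧
    Φ.m V 0 ≠ 0 ∧
    ∀ θ θs φ ϕ : ℕ → K, Φ.IsParameterArray V θ θs φ ϕ →
      (∀ j, 1 ≤ j → j ≤ d → φ j ≠ 0 ∧ ϕ j ≠ 0) ∧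
      -- the scalars `b_i`, `c_i`, computed in any standard basis
      (∀ v : Module.Basis (Fin (d + 1)) K V, Φ.IsStandardBasis v →
        (∀ i, i < d → Φ.b v i = φ (i + 1) *
          ((LeonardSystem.tau θs i).eval (θs i) /
            (LeonardSystem.tau θs (i + 1)).eval (θs (i + 1)))) ∧
        (∀ i, 1 ≤ i → i ≤ d → Φ.c v i = ϕ i *
          ((LeonardSystem.eta d θs (d - i)).eval (θs i) /
            (LeonardSystem.eta d θs (d - i + 1)).eval (θs (i - 1))))) ∧
      -- the scalars `a_i`; for `i = 0` and `i = d` one of the fractions has numerator `0`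
      (∀ i : Fin (d + 1), Φ.a V i = θ i + φ i / (θs i - θs (i - 1)) +
        φ (i + 1) / (θs i - θs (i + 1))) ∧
      -- the scalars `x_i`
      (∀ i, 1 ≤ i → i ≤ d → Φ.x V i = φ i * ϕ i *
        (((LeonardSystem.tau θs (i - 1)).eval (θs (i - 1)) *
            (LeonardSystem.eta d θs (d - i)).eval (θs i)) /
          ((LeonardSystem.tau θs i).eval (θs i) *
            (LeonardSystem.eta d θs (d - i + 1)).eval (θs (i - 1))))) ∧
      -- the scalar `ν`
      Φ.nu V = ((LeonardSystem.eta d θ d).eval (θ 0) * (LeonardSystem.eta d θs d).eval (θs 0)) /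
        ∏ j ∈ Finset.Icc 1 d, ϕ j ∧
      -- the scalars `k_i`
      (∀ i : Fin (d + 1), Φ.k V i =
        ((∏ j ∈ Finset.Icc 1 (i : ℕ), φ j) / ∏ j ∈ Finset.Icc 1 (i : ℕ), ϕ j) *
          ((LeonardSystem.eta d θs d).eval (θs 0) /
            ((LeonardSystem.tau θs i).eval (θs i) *
              (LeonardSystem.eta d θs (d - i)).eval (θs i)))) ∧
      -- the scalars `m_i`
      (∀ i : Fin (d + 1), Φ.m V i =
        ((∏ j ∈ Finset.Icc 1 (i : ℕ), φ j) * ∏ j ∈ Finset.Icc 1 (d - i), ϕ j) /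
          ((LeonardSystem.eta d θs d).eval (θs 0) *
            ((LeonardSystem.tau θ i).eval (θ i) *
              (LeonardSystem.eta d θ (d - i)).eval (θ i)))) := by
  obtain ⟨e⟩ := h𝒜
  have hbij := lsmul_bijective_of_algEquiv_matrix V e
  have hV := finrank_eq_of_algEquiv_matrix V e
  refine ⟨Φ.exists_isParameterArray hbij hV, Φ.exists_isStandardBasis hbij hV,
    LeonardSystem.m_zero_ne_zero hbij hV, fun θ θs φ ϕ h =>
      ⟨fun j h1 hj => h.ne_zero hbij hV h1 hj, fun v hv => ?_, LeonardSystem.a_eq hbij hV h,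
        fun i h1 hi => LeonardSystem.x_eq hbij hV h h1 hi, LeonardSystem.nu_eq hbij hV h,
        LeonardSystem.k_eq hbij hV h, LeonardSystem.m_eq hbij hV h⟩⟩
  obtain ⟨w, hw, hvs, hwv⟩ := LeonardSystem.IsStandardBasis.exists_basis Φ hbij hV hv
  refine ⟨fun i hi => ?_, fun i h1 hi => ?_⟩
  · rw [LeonardSystem.b, dif_pos hi, LeonardSystem.repMatrix_apply_eq]
    exact LeonardSystem.superdiag_eq hbij hV h hw hvs hwv hi
  · obtain ⟨i, rfl⟩ : ∃ j, i = j + 1 := ⟨i - 1, by omega⟩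
    rw [LeonardSystem.c, dif_pos ⟨h1, hi⟩, LeonardSystem.repMatrix_apply_eq]
    exact LeonardSystem.subdiag_eq hbij hV h hw hvs hwv hi
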